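/- Let $n,T,a,b\ge 0$ be integers. Fix an isometric encoding of the $n$-qubit space into a finite-dimensional space and a unit vector $|\bot\rangle$ in that space that is orthogonal to every encoded $n$-qubit state. For an $n$-qubit state $|\psi\rangle$ let $\mathcal O_\psi=1-2|\chi\rangle\langle\chi|$, where $|\chi\rangle=(|\psi\rangle-|\bot\rangle)/\sqrt2$; this is the canonical state preparation oracle. The random state preparation oracle $U_\psi$ is $U_\psi=VW$, where $V$ is any fixed $n$-qubit unitary with $V|0^n\rangle=|\psi\rangle$ and $W$ fixes $|0^n\rangle$ and is Haar-random on the $(2^n-1)$-dimensional orthogonal complement of $|0^n\rangle$ (the distribution of $U_\psi$ does not depend on the choice of $V$). A quantum query algorithm with $a$ input and $b$ output qubits may apply unitary gates, initialize and discard ancillas, measure, make random choices and continue depending on classical outcomes. A query to a unitary $U$ is one application of $U$, $U^\dagger$, controlled-$U$ or controlled-$U^\dagger$. An algorithm with a fixed oracle is identified with its superoperator from density matrices on $a$ qubits to density matrices on $b$ qubits. $\mathbb E_{U_\psi}[A]$ is the average of the superoperator of $A$ when a single sample of $U_\psi$ is used for all queries of a run. Theorem. Let $A$ be a quantum query algorithm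 that makes $T$ queries to an $n$-qubit unitary. Then there is a quantum query algorithm $B$ that makes $2T$ queries, with the same input and output qubits, such that for every $n$-qubit state $|\psi\rangle$, when $A$ queries $U_\psi$ and $B$ queries $\mathcal O_\psi$, $$\Bigl\|\mathop{\mathbb E}_{U_\psi}[A]-B\Bigr\|_\diamond\le\frac{10T+4}{2^{n/2}}.$$ -/

import Mathlib

open scoped Matrix Kronecker

noncomputable section

namespace QuantumQuery

/-! ### Registers, superoperators, trace norm and diamond norm -/

/-- Labels of the computational basis of `m` qubits. -/
abbrev Qubits (m : ℕ) : Type := Fin m → Bool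

/-- The label of the all-zeros basis state of `n` qubits. -/
abbrev zeroString (n : ℕ) : Qubits n := fun _ => false

/-- The basis vector labelled by `x`. -/
abbrev ket {X : Type} [DecidableEq X] (x : X) : X → ℂ := Pi.single x 1

/-- `v` is a (pure, normalized) state. -/
def IsState {X : Type} [Fintype X] (v : X → ℂ) : Prop := star v ⬝ᵥ v = 1

/-- The superoperator `ρ ↦ K ρ K†`. -/
def conj {X Y : Type} [Fintype X] (K : Matrix Y X ℂ) :
    Matrix X X ℂ →ₗ[ℂ] Matrix Y Y ℂ where
  toFun ρ := K * ρ * Kᴴ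
  map_add' ρ σ := by rw [Matrix.mul_add, Matrix.add_mul]
  map_smul' c ρ := by simp

/-- The operator `Φ ⊗ id` on matrices over `X ⊗ ℂᵏ`. -/
def ampliate {X Y : Type} (Φ : Matrix X X ℂ →ₗ[ℂ] Matrix Y Y ℂ) (k : ℕ)
    (M : Matrix (X × Fin k) (X × Fin k) ℂ) : Matrix (Y × Fin k) (Y × Fin k) ℂ :=
  Matrix.of fun p q => Φ (Matrix.of fun x x' => M (x, p.2) (x', q.2)) p.1 q.1

/-- The trace norm: the sum of the singular values, which are the square roots of the eigenvalues
of `M† M`. -/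
def traceNorm {X : Type} [Fintype X] [DecidableEq X] (M : Matrix X X ℂ) : ℝ :=
  ∑ i, Real.sqrt ((Matrix.isHermitian_conjTranspose_mul_self M).eigenvalues i)

/-- The diamond norm: the supremum over `k` of the operator norm of `Φ ⊗ id_k` for the trace
norms. The value is taken in `[0, ∞]`, so that the supremum always makes sense. -/
def diamondNorm {X Y : Type} [Fintype X] [DecidableEq X] [Fintype Y] [DecidableEq Y]
    (Φ : Matrix X X ℂ →ₗ[ℂ] Matrix Y Y ℂ) : ENNReal :=
  ⨆ (k : ℕ) (M : Matrix (X × Fin k) (X × Fin k) ℂ) (_ : traceNorm M ≤ 1),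
    ENNReal.ofReal (traceNorm (ampliate Φ k M))

/-! ### Query algorithms -/

/-- The four forms of a query to a unitary `U`: `U`, `U†`, controlled-`U`, controlled-`U†`. -/
inductive QueryKind : Type
  | plain
  | inverse
  | controlled
  | controlledInverse

/-- The operator `|0⟩⟨0| ⊗ 1 + |1⟩⟨1| ⊗ U`. -/
def controlledOp {Q : Type} [DecidableEq Q] (U : Matrix Q Q ℂ) :
    Matrix (Bool × Q) (Bool × Q) ℂ :=
  Matrix.single false false (1 : ℂ) ⊗ₖ (1 : Matrix Q Q ℂ) + Matrix.single true true (1 : ℂ) ⊗ₖ U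

/-- The operator that a query applies to the pair (control qubit, query register). The control
qubit is idle in the uncontrolled forms. -/
def QueryKind.op {Q : Type} [DecidableEq Q] (U : Matrix Q Q ℂ) :
    QueryKind → Matrix (Bool × Q) (Bool × Q) ℂ
  | plain => (1 : Matrix Bool Bool ℂ) ⊗ₖ U
  | inverse => (1 : Matrix Bool Bool ℂ) ⊗ₖ Uᴴ
  | controlled => controlledOp U
  | controlledInverse => controlledOp Uᴴ

/-- The memory of an algorithm: `w` workspace qubits, one control qubit, and the register `Q` on
which the oracle acts. -/
abbrev Memory (Q : Type) (w : ℕ) : Type := Qubits w × Bool × Q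

/-- The rest of a run of an algorithm whose memory has `w` workspace qubits, with `T` queries
still to be made and `b` output qubits.

Between queries an algorithm applies quantum instruments, given by operators `K i` with
`∑ i, (K i)† (K i) = 1`: outcome `i` replaces the (unnormalized) state `ρ` by `(K i) ρ (K i)†`, and
the rest of the algorithm may depend on `i`. Unitary gates, initialization and discarding of
qubits, measurements, and classical random choices are special cases. -/
inductive Program (Q : Type) [Fintype Q] [DecidableEq Q] (b : ℕ) : ℕ → ℕ → Type
  | output {w r : ℕ} (K : Fin r → Matrix (Qubits b) (Memory Q w) ℂ)
      (hK : ∑ i, (K i)ᴴ * K i = 1) : Program Q b w 0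
  | instrument {w w' r T : ℕ} (K : Fin r → Matrix (Memory Q w') (Memory Q w) ℂ)
      (hK : ∑ i, (K i)ᴴ * K i = 1) (next : Fin r → Program Q b w' T) : Program Q b w T
  | query {w T : ℕ} (kind : QueryKind) (next : Program Q b w T) : Program Q b w (T + 1)

/-- The superoperator of a program when the oracle is `U`. -/
def Program.run {Q : Type} [Fintype Q] [DecidableEq Q] {b : ℕ} (U : Matrix Q Q ℂ) :
    {w T : ℕ} → Program Q b w T →
      (Matrix (Memory Q w) (Memory Q w) ℂ →ₗ[ℂ] Matrix (Qubits b) (Qubits b) ℂ)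
  | _, _, .output K _ => ∑ i, conj (K i)
  | _, _, .instrument K _ next => ∑ i, (next i).run U ∘ₗ conj (K i)
  | w, _, .query kind next =>
      next.run U ∘ₗ conj ((1 : Matrix (Qubits w) (Qubits w) ℂ) ⊗ₖ kind.op U)

/-- A quantum algorithm with `a` input qubits and `b` output qubits that makes `T` queries to a
unitary on the register `Q`: an instrument that loads the input into the memory, followed by
a program. -/
structure Algorithm (Q : Type) [Fintype Q] [DecidableEq Q] (a b T : ℕ) : Type where
  w : ℕ
  r : ℕ
  load : Fin r → Matrix (Memory Q w) (Qubits a) ℂ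
  load_complete : ∑ i, (load i)ᴴ * load i = 1
  program : Fin r → Program Q b w T

/-- The superoperator of an algorithm when the oracle is `U`. -/
def Algorithm.run {Q : Type} [Fintype Q] [DecidableEq Q] {a b T : ℕ} (A : Algorithm Q a b T)
    (U : Matrix Q Q ℂ) : Matrix (Qubits a) (Qubits a) ℂ →ₗ[ℂ] Matrix (Qubits b) (Qubits b) ℂ :=
  ∑ i, (A.program i).run U ∘ₗ conj (A.load i)

/-! ### The canonical state preparation oracle -/

/-- The reflection `1 - 2 |χ⟩⟨χ|`. -/
def reflection {Q : Type} [DecidableEq Q] (χ : Q → ℂ) : Matrix Q Q ℂ :=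
  1 - (2 : ℂ) • Matrix.vecMulVec χ (star χ)

/-- An encoding of `n` qubits into a space with basis `Q`, that is, an isometry `J`, together with
a state `bot` orthogonal to all encoded `n`-qubit states. -/
structure Encoding (n : ℕ) (Q : Type) [Fintype Q] [DecidableEq Q] : Type where
  J : Matrix Q (Qubits n) ℂ
  isometry : Jᴴ * J = 1
  bot : Q → ℂ
  bot_isState : IsState bot
  bot_orthogonal : ∀ ψ : Qubits n → ℂ, star bot ⬝ᵥ (J *ᵥ ψ) = 0

/-- The canonical state preparation oracle: the reflection about `(|ψ⟩ - |⊥⟩) / √2`. -/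
def canonicalOracle {n : ℕ} {Q : Type} [Fintype Q] [DecidableEq Q] (E : Encoding n Q)
    (ψ : Qubits n → ℂ) : Matrix Q Q ℂ :=
  reflection (((1 / Real.sqrt 2 : ℝ) : ℂ) • (E.J *ᵥ ψ - E.bot))

/-! ### The random state preparation oracle -/

/-- The unitaries of the span of the nonzero basis states, the orthogonal complement of
`|0ⁿ⟩`. -/
abbrev ComplementUnitary (n : ℕ) : Type :=
  Matrix.unitaryGroup {x : Qubits n // ¬ x = zeroString n} ℂ

instance complementUnitary_compactSpace (n : ℕ) : CompactSpace (ComplementUnitary n) := by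
  apply isCompact_iff_compactSpace.mp
  have hb : IsCompact (Set.univ.pi fun _ : {x : Qubits n // ¬ x = zeroString n} =>
      Set.univ.pi fun _ : {x : Qubits n // ¬ x = zeroString n} => Metric.closedBall (0 : ℂ) 1) :=
    isCompact_univ_pi fun _ => isCompact_univ_pi fun _ => isCompact_closedBall _ _
  refine hb.of_isClosed_subset (isClosed_unitary (R := Matrix _ _ ℂ)) ?_
  intro U hU i _ j _
  simpa using entry_norm_bound_of_unitary hU i j

instance complementUnitary_measurableSpace (n : ℕ) : MeasurableSpace (ComplementUnitary n) :=
  borel _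

instance complementUnitary_borelSpace (n : ℕ) : BorelSpace (ComplementUnitary n) := ⟨rfl⟩

/-- The Haar probability measure on the unitaries of the complement of `|0ⁿ⟩`. -/
def haar (n : ℕ) : MeasureTheory.Measure (ComplementUnitary n) :=
  MeasureTheory.Measure.haarMeasure ⊤

instance haar_isProbabilityMeasure (n : ℕ) : MeasureTheory.IsProbabilityMeasure (haar n) :=
  ⟨by simpa [haar] using
    MeasureTheory.Measure.haarMeasure_self (K₀ := (⊤ : TopologicalSpace.PositiveCompacts
      (ComplementUnitary n)))⟩

/-- The operator on `n` qubits that fixes `|0ⁿ⟩` and acts as `W` on its orthogonal complement. -/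
def extendByZeroString {n : ℕ} (W : ComplementUnitary n) : Matrix (Qubits n) (Qubits n) ℂ :=
  Matrix.reindex (Equiv.sumCompl fun x => x = zeroString n)
    (Equiv.sumCompl fun x => x = zeroString n) (Matrix.fromBlocks 1 0 0 W.val)

/-- The random state preparation oracle `V W`, for a given unitary `V` (which prepares the state
`V |0ⁿ⟩`) and the sample `W`. -/
def randomOracle {n : ℕ} (V : Matrix (Qubits n) (Qubits n) ℂ) (W : ComplementUnitary n) :
    Matrix (Qubits n) (Qubits n) ℂ :=
  V * extendByZeroString W

theorem continuous_extendByZeroString (n : ℕ) :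
    Continuous (extendByZeroString : ComplementUnitary n → _) := by
  exact (Continuous.matrix_fromBlocks continuous_const continuous_const continuous_const
    continuous_subtype_val).matrix_reindex _ _

theorem QueryKind.continuous_op {Q : Type} [DecidableEq Q] (k : QueryKind) :
    Continuous fun U : Matrix Q Q ℂ => k.op U := by
  refine continuous_matrix fun p q => ?_
  cases k <;>
    simp only [QueryKind.op, controlledOp, Matrix.add_apply, Matrix.kroneckerMap_apply,
      Matrix.conjTranspose_apply] <;> fun_prop

theorem Program.continuous_run {Q : Type} [Fintype Q] [DecidableEq Q] {b w T : ℕ}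
    (P : Program Q b w T) {Ω : Type} [TopologicalSpace Ω] {U : Ω → Matrix Q Q ℂ}
    {ρ : Ω → Matrix (Memory Q w) (Memory Q w) ℂ} (hU : Continuous U) (hρ : Continuous ρ) :
    Continuous fun ω => P.run (U ω) (ρ ω) := by
  induction P with
  | output K hK =>
    simp only [Program.run, LinearMap.sum_apply, conj, LinearMap.coe_mk, AddHom.coe_mk]
    fun_prop
  | instrument K hK next ih =>
    simp only [Program.run, LinearMap.sum_apply, LinearMap.comp_apply]
    refine continuous_finsetSum _ fun i _ => ih i ?_
    simp only [conj, LinearMap.coe_mk, AddHom.coe_mk]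
    fun_prop
  | @query w T kind next ih =>
    simp only [Program.run, LinearMap.comp_apply]
    refine ih ?_
    have h : Continuous fun ω => (1 : Matrix (Qubits w) (Qubits w) ℂ) ⊗ₖ kind.op (U ω) :=
      continuous_matrix fun p q => by
        simp only [Matrix.kroneckerMap_apply]
        exact continuous_const.mul (((kind.continuous_op).comp hU).matrix_elem _ _)
    simp only [conj, LinearMap.coe_mk, AddHom.coe_mk]
    exact (h.matrix_mul hρ).matrix_mul h.matrix_conjTranspose

theorem Algorithm.integrable_run {n a b T : ℕ} (A : Algorithm (Qubits n) a b T)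
    (V : Matrix (Qubits n) (Qubits n) ℂ) (ρ : Matrix (Qubits a) (Qubits a) ℂ) (y y' : Qubits b) :
    MeasureTheory.Integrable (fun W => A.run (randomOracle V W) ρ y y') (haar n) := by
  have hU : Continuous fun W : ComplementUnitary n => randomOracle V W :=
    continuous_const.matrix_mul (continuous_extendByZeroString n)
  have h : Continuous fun W => A.run (randomOracle V W) ρ := by
    simp only [Algorithm.run, LinearMap.sum_apply, LinearMap.comp_apply]
    exact continuous_finsetSum _ fun i _ => (A.program i).continuous_run hU continuous_const
  exact (h.matrix_elem y y').integrable_of_hasCompactSupport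
    (HasCompactSupport.of_compactSpace _)

/-- The superoperator `E[A]`: the average of the superoperators of `A` over the random oracle
`V W`, with one sample `W` for all queries of a run. -/
def Algorithm.average {n a b T : ℕ} (A : Algorithm (Qubits n) a b T)
    (V : Matrix (Qubits n) (Qubits n) ℂ) :
    Matrix (Qubits a) (Qubits a) ℂ →ₗ[ℂ] Matrix (Qubits b) (Qubits b) ℂ where
  toFun ρ := Matrix.of fun y y' => ∫ W, A.run (randomOracle V W) ρ y y' ∂(haar n)
  map_add' ρ σ := by
    ext y y'
    simp only [map_add, Matrix.add_apply, Matrix.of_apply]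
    exact MeasureTheory.integral_add (A.integrable_run V ρ y y') (A.integrable_run V σ y y')
  map_smul' c ρ := by
    ext y y'
    simp only [map_smul, Matrix.smul_apply, Matrix.of_apply, RingHom.id_apply]
    exact MeasureTheory.integral_smul c _

end QuantumQuery

end

noncomputable section

namespace QuantumQuery

open scoped Matrix.Norms.L2Operator

/-! ### Euclidean norm of coordinate vectors and operator norm bounds -/

/-! For orthogonal states φ and ψ, the reflection `1 - |w⟩⟨w|` with `w = φ - ψ` swaps them.
Conjugating the canonical oracle O_φ, whose axis is φ - ⊥, by O_ψ turns this axis into φ - ψ. So O_ψ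
O_φ O_ψ maps φ to ψ at the price of two queries to O_ψ, provided that φ is known. For general φ put
α = ⟨ψ|φ⟩: the axis becomes φ - (1 + α)ψ + α⊥, and on the encoded space O_ψ O_φ O_ψ is within 5|α|
in operator norm of an exact unitary `exchange φ ψ` that maps φ to ψ (`norm_exchange_sub_le`).

The algorithm B must not depend on ψ, so it draws φ = |x⟩ uniformly among the basis states. The mean
of |⟨ψ|x⟩| is at most 2^(-n/2) by Cauchy–Schwarz (`sum_norm_le_sqrt`). By left invariance of Haar
measure the average of A depends only on V|0ⁿ⟩ (`Algorithm.average_congr`), so for each x separately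
V may be replaced by `exchange (ket x) ψ * shift x`. The oracle VW then factors into the exchange,
simulated by two queries, and `shift x * W`, which B can apply by itself once it has sampled W. Only
finitely many outcomes are available to B, so Haar measure is replaced by a finite average on a fine
net (`Algorithm.exists_finite_average`); this is the source of the summand 4.

A hybrid argument converts an operator error δ per query into 2Tδ for the superoperator
(`Program.dBound_run_sub_simulate`), which with δ = 5|ψ x| averages to 10T/2^(n/2). Superoperators
are compared through `DBound`, which tests rank-one inputs against contractions. It needs only the
triangle inequality for complex numbers and is therefore easy to sum and average; the singular value
decomposition and trace norm duality convert it into a diamond norm bound. -/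

/-- The Euclidean norm of a coordinate vector. -/
def nrm {X : Type} [Fintype X] (f : X → ℂ) : ℝ := ‖WithLp.toLp 2 f‖

section Norms

variable {X Y Z : Type} [Fintype X] [Fintype Y] [Fintype Z]

theorem nrm_nonneg (f : X → ℂ) : 0 ≤ nrm f := norm_nonneg _

theorem nrm_sq (f : X → ℂ) : nrm f ^ 2 = ∑ x, ‖f x‖ ^ 2 := EuclideanSpace.norm_sq_eq _

theorem nrm_smul (c : ℂ) (f : X → ℂ) : nrm (c • f) = ‖c‖ * nrm f := by
  simp [nrm, norm_smul]

theorem star_dotProduct_self (f : X → ℂ) : star f ⬝ᵥ f = ((nrm f ^ 2 : ℝ) : ℂ) := by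
  rw [nrm_sq, Complex.ofReal_sum]
  refine Finset.sum_congr rfl fun x _ => ?_
  rw [Pi.star_apply, Complex.star_def, Complex.conj_mul', Complex.ofReal_pow]

theorem nrm_eq_one {f : X → ℂ} (hf : IsState f) : nrm f = 1 := by
  have h := star_dotProduct_self f
  rw [hf] at h
  have h2 : nrm f ^ 2 = 1 := by exact_mod_cast h.symm
  nlinarith [nrm_nonneg f]

theorem norm_dotProduct_le (f g : X → ℂ) : ‖star f ⬝ᵥ g‖ ≤ nrm f * nrm g := by
  have h := norm_inner_le_norm (𝕜 := ℂ) (WithLp.toLp 2 f) (WithLp.toLp 2 g)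
  rw [EuclideanSpace.inner_toLp_toLp, dotProduct_comm] at h
  exact h

variable [DecidableEq X]

theorem nrm_mulVec_le (A : Matrix Y X ℂ) (f : X → ℂ) : nrm (A *ᵥ f) ≤ ‖A‖ * nrm f :=
  Matrix.l2_opNorm_mulVec A (WithLp.toLp 2 f)

theorem opNorm_le_of_nrm_le {A : Matrix Y X ℂ} {c : ℝ} (hc : 0 ≤ c)
    (h : ∀ f, nrm (A *ᵥ f) ≤ c * nrm f) : ‖A‖ ≤ c := by
  rw [Matrix.l2_opNorm_def]
  refine ContinuousLinearMap.opNorm_le_bound _ hc fun f => ?_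
  exact h f.ofLp

theorem norm_vecMulVec_le (u : Y → ℂ) (v : X → ℂ) :
    ‖Matrix.vecMulVec u (star v)‖ ≤ nrm u * nrm v := by
  refine opNorm_le_of_nrm_le (mul_nonneg (nrm_nonneg _) (nrm_nonneg _)) fun f => ?_
  rw [Matrix.vecMulVec_mulVec]
  simp only [op_smul_eq_smul]
  rw [nrm_smul, mul_comm, mul_assoc]
  exact mul_le_mul_of_nonneg_left (norm_dotProduct_le v f) (nrm_nonneg _)

theorem norm_one_le : ‖(1 : Matrix X X ℂ)‖ ≤ 1 := by
  rw [← Matrix.diagonal_one, Matrix.l2_opNorm_diagonal]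
  exact (pi_norm_le_iff_of_nonneg zero_le_one).2 fun _ => by simp

theorem norm_isometry_le {A : Matrix Y X ℂ} (h : Aᴴ * A = 1) : ‖A‖ ≤ 1 := by
  have h1 := Matrix.l2_opNorm_conjTranspose_mul_self A
  rw [h] at h1
  nlinarith [norm_one_le (X := X), norm_nonneg A]

variable [DecidableEq Z]

/-- On square matrices, tensoring with the identity is a star homomorphism, hence contractive. The
C*-identity carries this over to rectangular matrices. -/
theorem norm_kronecker_one_le (A : Matrix Y X ℂ) :
    ‖A ⊗ₖ (1 : Matrix Z Z ℂ)‖ ≤ ‖A‖ := by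
  let φ : Matrix X X ℂ →⋆ₙₐ[ℂ] Matrix (X × Z) (X × Z) ℂ :=
    { toFun := fun M => M ⊗ₖ 1
      map_smul' := fun c M => by simp [Matrix.smul_kronecker]
      map_zero' := by simp
      map_add' := fun M N => Matrix.add_kronecker M N 1
      map_mul' := fun M N => by rw [← Matrix.mul_kronecker_mul, mul_one]
      map_star' := fun M => by
        simp [Matrix.star_eq_conjTranspose, Matrix.conjTranspose_kronecker] }
  have h : ‖(Aᴴ * A) ⊗ₖ (1 : Matrix Z Z ℂ)‖ ≤ ‖Aᴴ * A‖ :=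
    NonUnitalStarAlgHom.norm_apply_le φ (Aᴴ * A)
  have h2 : (Aᴴ * A) ⊗ₖ (1 : Matrix Z Z ℂ) = (A ⊗ₖ (1 : Matrix Z Z ℂ))ᴴ * (A ⊗ₖ (1 : Matrix Z Z ℂ)) := by
    rw [Matrix.conjTranspose_kronecker, ← Matrix.mul_kronecker_mul]; simp
  rw [h2, Matrix.l2_opNorm_conjTranspose_mul_self, Matrix.l2_opNorm_conjTranspose_mul_self] at h
  exact (mul_self_le_mul_self_iff (norm_nonneg _) (norm_nonneg _)).2 h

theorem norm_one_kronecker_le (A : Matrix Y X ℂ) :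
    ‖(1 : Matrix Z Z ℂ) ⊗ₖ A‖ ≤ ‖A‖ := by
  let φ : Matrix X X ℂ →⋆ₙₐ[ℂ] Matrix (Z × X) (Z × X) ℂ :=
    { toFun := fun M => 1 ⊗ₖ M
      map_smul' := fun c M => by simp [Matrix.kronecker_smul]
      map_zero' := by simp
      map_add' := fun M N => Matrix.kronecker_add 1 M N
      map_mul' := fun M N => by rw [← Matrix.mul_kronecker_mul, mul_one]
      map_star' := fun M => by
        simp [Matrix.star_eq_conjTranspose, Matrix.conjTranspose_kronecker] }
  have h : ‖(1 : Matrix Z Z ℂ) ⊗ₖ (Aᴴ * A)‖ ≤ ‖Aᴴ * A‖ :=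
    NonUnitalStarAlgHom.norm_apply_le φ (Aᴴ * A)
  have h2 : (1 : Matrix Z Z ℂ) ⊗ₖ (Aᴴ * A) = ((1 : Matrix Z Z ℂ) ⊗ₖ A)ᴴ * ((1 : Matrix Z Z ℂ) ⊗ₖ A) := by
    rw [Matrix.conjTranspose_kronecker, ← Matrix.mul_kronecker_mul]; simp
  rw [h2, Matrix.l2_opNorm_conjTranspose_mul_self, Matrix.l2_opNorm_conjTranspose_mul_self] at h
  exact (mul_self_le_mul_self_iff (norm_nonneg _) (norm_nonneg _)).2 h

theorem sum_nrm_sq_of_complete {ι : Type} [Fintype ι] {K : ι → Matrix Y X ℂ}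
    (hK : ∑ i, (K i)ᴴ * K i = 1) (f : X → ℂ) : ∑ i, nrm (K i *ᵥ f) ^ 2 = nrm f ^ 2 := by
  have h : ∀ i, ((nrm (K i *ᵥ f) ^ 2 : ℝ) : ℂ) = star f ⬝ᵥ (((K i)ᴴ * K i) *ᵥ f) := fun i => by
    rw [← star_dotProduct_self, Matrix.star_mulVec, Matrix.dotProduct_mulVec,
      Matrix.dotProduct_mulVec, Matrix.vecMul_vecMul]
  have h2 : ((∑ i, nrm (K i *ᵥ f) ^ 2 : ℝ) : ℂ) = ((nrm f ^ 2 : ℝ) : ℂ) := by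
    rw [Complex.ofReal_sum, Finset.sum_congr rfl fun i _ => h i, ← dotProduct_sum,
      ← Matrix.sum_mulVec, hK, Matrix.one_mulVec, star_dotProduct_self]
  exact_mod_cast h2

/-! ### Trace norm duality -/

-- The contraction is the adjoint of the partial isometry in the polar decomposition of `N`, namely
-- |N|⁻¹N† written in an eigenbasis of N†N. The convention 0⁻¹ = 0 makes it vanish where the
-- singular values do.
open scoped ComplexOrder in
theorem exists_trace_mul_eq_traceNorm (N : Matrix X X ℂ) :
    ∃ C : Matrix X X ℂ, ‖C‖ ≤ 1 ∧ (C * N).trace = (traceNorm N : ℂ) := by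
  have hH := Matrix.isHermitian_conjTranspose_mul_self N
  set s : X → ℝ := fun i => Real.sqrt (hH.eigenvalues i) with hs
  have hnn : ∀ i, 0 ≤ hH.eigenvalues i :=
    (Matrix.posSemidef_conjTranspose_mul_self N).eigenvalues_nonneg
  have hss : ∀ i, hH.eigenvalues i = s i * s i := fun i => (Real.mul_self_sqrt (hnn i)).symm
  set U : Matrix X X ℂ := hH.eigenvectorUnitary.1 with hU
  have hUU : Uᴴ * U = 1 := Unitary.coe_star_mul_self hH.eigenvectorUnitary
  have hsp : Nᴴ * N = U * Matrix.diagonal (fun i => ((s i * s i : ℝ) : ℂ)) * Uᴴ := by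
    have h := hH.spectral_theorem
    rw [Unitary.conjStarAlgAut_apply] at h
    rw [h]
    simp only [Matrix.star_eq_conjTranspose]
    congr 3
    ext i
    simp [hss]
  set D : Matrix X X ℂ := Matrix.diagonal (fun i => (((s i)⁻¹ : ℝ) : ℂ)) with hD
  have hDH : Dᴴ = D := by
    rw [hD, Matrix.diagonal_conjTranspose]; congr 1; ext i; simp
  have hcancel : ∀ A : Matrix X X ℂ, Uᴴ * (U * A) = A := fun A => by
    rw [← Matrix.mul_assoc, hUU, Matrix.one_mul]
  refine ⟨U * D * Uᴴ * Nᴴ, ?_, ?_⟩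
  · have h1 : (U * D * Uᴴ * Nᴴ) * (U * D * Uᴴ * Nᴴ)ᴴ
        = U * Matrix.diagonal (fun i => ((s i * (s i)⁻¹ : ℝ) : ℂ) ^ 2) * Uᴴ := by
      simp only [Matrix.conjTranspose_mul, Matrix.conjTranspose_conjTranspose, hDH]
      calc _ = U * (D * (Uᴴ * (Nᴴ * N) * U) * D) * Uᴴ := by simp only [Matrix.mul_assoc]
        _ = _ := by
          rw [hsp]
          have : Uᴴ * (U * Matrix.diagonal (fun i => ((s i * s i : ℝ) : ℂ)) * Uᴴ) * U
              = Matrix.diagonal (fun i => ((s i * s i : ℝ) : ℂ)) := by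
            simp only [Matrix.mul_assoc, hcancel, hUU, Matrix.mul_one]
          rw [this, hD, Matrix.diagonal_mul_diagonal, Matrix.diagonal_mul_diagonal]
          congr 3
          ext i
          push_cast
          ring
    have h2 : ‖(U * D * Uᴴ * Nᴴ) * (U * D * Uᴴ * Nᴴ)ᴴ‖ ≤ 1 := by
      rw [h1]
      have hn : ‖Matrix.diagonal (fun i => ((s i * (s i)⁻¹ : ℝ) : ℂ) ^ 2)‖ ≤ 1 := by
        rw [Matrix.l2_opNorm_diagonal]
        refine (pi_norm_le_iff_of_nonneg zero_le_one).2 fun i => ?_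
        by_cases h0 : s i = 0
        · simp [h0]
        · simp [mul_inv_cancel₀ (Complex.ofReal_ne_zero.2 h0)]
      have hU1 := norm_isometry_le hUU
      have hU2 : ‖Uᴴ‖ ≤ 1 := by rwa [Matrix.l2_opNorm_conjTranspose]
      refine (Matrix.l2_opNorm_mul _ _).trans (mul_le_one₀ ?_ (norm_nonneg _) hU2)
      exact (Matrix.l2_opNorm_mul _ _).trans (mul_le_one₀ hU1 (norm_nonneg _) hn)
    have h3 := Matrix.l2_opNorm_conjTranspose_mul_self (U * D * Uᴴ * Nᴴ)ᴴ
    rw [Matrix.conjTranspose_conjTranspose, Matrix.l2_opNorm_conjTranspose] at h3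
    rw [h3] at h2
    nlinarith [norm_nonneg (U * D * Uᴴ * Nᴴ)]
  · rw [Matrix.mul_assoc, hsp]
    have : U * D * Uᴴ * (U * Matrix.diagonal (fun i => ((s i * s i : ℝ) : ℂ)) * Uᴴ)
        = U * Matrix.diagonal (fun i => (s i : ℂ)) * Uᴴ := by
      simp only [Matrix.mul_assoc, hcancel]
      rw [← Matrix.mul_assoc D, hD, Matrix.diagonal_mul_diagonal]
      congr 3
      ext i
      by_cases h0 : s i = 0
      · simp [h0]
      · have := Complex.ofReal_ne_zero.2 h0
        push_cast
        field_simp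
    rw [this, Matrix.trace_mul_comm, hcancel, Matrix.trace_diagonal, traceNorm,
      Complex.ofReal_sum]

/-- This is the singular value decomposition: expand `M` along the eigenbasis e_i of M†M, where ‖M
e_i‖ is the i-th singular value. -/
theorem exists_sum_vecMulVec_eq (M : Matrix X X ℂ) :
    ∃ f e : X → X → ℂ, M = ∑ i, Matrix.vecMulVec (f i) (star (e i)) ∧
      ∑ i, nrm (f i) * nrm (e i) = traceNorm M := by
  have hH := Matrix.isHermitian_conjTranspose_mul_self M
  set U : Matrix X X ℂ := hH.eigenvectorUnitary.1 with hU
  have hUU : U * Uᴴ = 1 := Unitary.coe_mul_star_self hH.eigenvectorUnitary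
  let e : X → X → ℂ := fun i => (hH.eigenvectorBasis i).ofLp
  have he : ∀ i, nrm (e i) = 1 := fun i => hH.eigenvectorBasis.orthonormal.1 i
  have hUe : ∀ i x, U x i = e i x := fun i x => hH.eigenvectorUnitary_apply x i
  have hMe : ∀ i, nrm (M *ᵥ e i) = Real.sqrt (hH.eigenvalues i) := fun i => by
    have h1 : star (M *ᵥ e i) ⬝ᵥ (M *ᵥ e i) = hH.eigenvalues i := by
      rw [Matrix.star_mulVec, Matrix.dotProduct_mulVec, Matrix.vecMul_vecMul,
        ← Matrix.dotProduct_mulVec, hH.mulVec_eigenvectorBasis, dotProduct_smul,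
        star_dotProduct_self, he]
      simp
    rw [star_dotProduct_self] at h1
    have h2 : nrm (M *ᵥ e i) ^ 2 = hH.eigenvalues i := by exact_mod_cast h1
    rw [← h2, Real.sqrt_sq (nrm_nonneg _)]
  refine ⟨fun i => M *ᵥ e i, e, ?_, ?_⟩
  · conv_lhs => rw [← Matrix.mul_one M, ← hUU]
    ext x y
    simp only [Matrix.sum_apply, Matrix.vecMulVec_apply, ← Matrix.mul_assoc]
    rw [Matrix.mul_apply]
    refine Finset.sum_congr rfl fun i _ => ?_
    rw [Matrix.conjTranspose_apply, hUe, Matrix.mul_apply]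
    simp only [hUe]
    rfl
  · simp only [he, hMe, mul_one, traceNorm]

end Norms

/-! ### Diamond norm bounds from rank-one inputs -/

section Superoperators

variable {X Y Z : Type}

theorem ampliate_add (Φ Ψ : Matrix X X ℂ →ₗ[ℂ] Matrix Y Y ℂ) (k : ℕ)
    (M : Matrix (X × Fin k) (X × Fin k) ℂ) :
    ampliate (Φ + Ψ) k M = ampliate Φ k M + ampliate Ψ k M := rfl

theorem ampliate_sub (Φ Ψ : Matrix X X ℂ →ₗ[ℂ] Matrix Y Y ℂ) (k : ℕ)
    (M : Matrix (X × Fin k) (X × Fin k) ℂ) :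
    ampliate (Φ - Ψ) k M = ampliate Φ k M - ampliate Ψ k M := rfl

theorem ampliate_smul (c : ℂ) (Φ : Matrix X X ℂ →ₗ[ℂ] Matrix Y Y ℂ) (k : ℕ)
    (M : Matrix (X × Fin k) (X × Fin k) ℂ) :
    ampliate (c • Φ) k M = c • ampliate Φ k M := rfl

theorem ampliate_sum {ι : Type} (s : Finset ι) (Φ : ι → Matrix X X ℂ →ₗ[ℂ] Matrix Y Y ℂ) (k : ℕ)
    (M : Matrix (X × Fin k) (X × Fin k) ℂ) :
    ampliate (∑ i ∈ s, Φ i) k M = ∑ i ∈ s, ampliate (Φ i) k M := by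
  ext p q
  simp [ampliate, Matrix.sum_apply]

theorem ampliate_apply_add (Φ : Matrix X X ℂ →ₗ[ℂ] Matrix Y Y ℂ) (k : ℕ)
    (M N : Matrix (X × Fin k) (X × Fin k) ℂ) :
    ampliate Φ k (M + N) = ampliate Φ k M + ampliate Φ k N := by
  ext p q
  exact congrFun (congrFun (map_add Φ (Matrix.of fun x x' => M (x, p.2) (x', q.2))
    (Matrix.of fun x x' => N (x, p.2) (x', q.2))) p.1) q.1

theorem ampliate_apply_zero (Φ : Matrix X X ℂ →ₗ[ℂ] Matrix Y Y ℂ) (k : ℕ) :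
    ampliate Φ k 0 = 0 := by
  ext p q
  change Φ 0 p.1 q.1 = _
  rw [map_zero]
  rfl

theorem ampliate_apply_sum {ι : Type} (s : Finset ι) (Φ : Matrix X X ℂ →ₗ[ℂ] Matrix Y Y ℂ) (k : ℕ)
    (M : ι → Matrix (X × Fin k) (X × Fin k) ℂ) :
    ampliate Φ k (∑ i ∈ s, M i) = ∑ i ∈ s, ampliate Φ k (M i) := by
  classical
  induction s using Finset.induction_on with
  | empty => simp [ampliate_apply_zero]
  | insert a s ha ih => rw [Finset.sum_insert ha, Finset.sum_insert ha, ampliate_apply_add, ih]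

theorem conj_comp_conj [Fintype X] [Fintype Y] (K : Matrix Z Y ℂ) (L : Matrix Y X ℂ) :
    conj K ∘ₗ conj L = conj (K * L) := by
  ext1 M
  simp [conj, Matrix.mul_assoc]

theorem conj_zero [Fintype X] : conj (0 : Matrix Y X ℂ) = 0 := by
  ext1 M
  simp [conj]

theorem conj_smul [Fintype X] (c : ℂ) (K : Matrix Y X ℂ) :
    conj (c • K) = (c * star c) • conj K := by
  ext1 M
  simp [conj, smul_smul, mul_comm]

theorem ampliate_comp_conj [Fintype X] [Fintype Y] (Φ : Matrix Y Y ℂ →ₗ[ℂ] Matrix Z Z ℂ)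
    (K : Matrix Y X ℂ) (k : ℕ) (M : Matrix (X × Fin k) (X × Fin k) ℂ) :
    ampliate (Φ ∘ₗ conj K) k M =
      ampliate Φ k ((K ⊗ₖ (1 : Matrix (Fin k) (Fin k) ℂ)) * M *
        (K ⊗ₖ (1 : Matrix (Fin k) (Fin k) ℂ))ᴴ) := by
  ext p q
  change Φ (conj K _) p.1 q.1 = Φ _ p.1 q.1
  refine congrArg (fun N => Φ N p.1 q.1) ?_
  ext y y'
  simp [conj, Matrix.mul_apply, Fintype.sum_prod_type, Matrix.one_apply, Matrix.kroneckerMap_apply,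
    apply_ite]

theorem ampliate_comp_conj_vecMulVec [Fintype X] [Fintype Y]
    (Φ : Matrix Y Y ℂ →ₗ[ℂ] Matrix Z Z ℂ) (K : Matrix Y X ℂ) (k : ℕ) (f e : X × Fin k → ℂ) :
    ampliate (Φ ∘ₗ conj K) k (Matrix.vecMulVec f (star e)) =
      ampliate Φ k (Matrix.vecMulVec ((K ⊗ₖ (1 : Matrix (Fin k) (Fin k) ℂ)) *ᵥ f)
        (star ((K ⊗ₖ (1 : Matrix (Fin k) (Fin k) ℂ)) *ᵥ e))) := by
  rw [ampliate_comp_conj, Matrix.mul_vecMulVec, Matrix.vecMulVec_mul, Matrix.star_mulVec]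

section Rank

variable [Fintype X] [Fintype Y] [DecidableEq Y]

/-- `Φ` maps rank-one operators `f e†` to operators of trace norm at most `c ‖f‖ ‖e‖`, in the
presence of any reference system. -/
def DBound (Φ : Matrix X X ℂ →ₗ[ℂ] Matrix Y Y ℂ) (c : ℝ) : Prop :=
  ∀ (k : ℕ) (f e : X × Fin k → ℂ) (C : Matrix (Y × Fin k) (Y × Fin k) ℂ), ‖C‖ ≤ 1 →
    ‖(C * ampliate Φ k (Matrix.vecMulVec f (star e))).trace‖ ≤ c * (nrm f * nrm e)

theorem DBound.diamondNorm_le [DecidableEq X] {Φ : Matrix X X ℂ →ₗ[ℂ] Matrix Y Y ℂ} {c : ℝ} (hc : 0 ≤ c)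
    (h : DBound Φ c) : diamondNorm Φ ≤ ENNReal.ofReal c := by
  refine iSup_le fun k => iSup_le fun M => iSup_le fun hM => ENNReal.ofReal_le_ofReal ?_
  obtain ⟨C, hC, hCN⟩ := exists_trace_mul_eq_traceNorm (ampliate Φ k M)
  obtain ⟨f, e, hfe, hs⟩ := exists_sum_vecMulVec_eq M
  have h0 : 0 ≤ traceNorm (ampliate Φ k M) := Finset.sum_nonneg fun _ _ => Real.sqrt_nonneg _
  calc traceNorm (ampliate Φ k M) = ‖(C * ampliate Φ k M).trace‖ := by
        rw [hCN, Complex.norm_real, Real.norm_of_nonneg h0]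
    _ = ‖∑ i, (C * ampliate Φ k (Matrix.vecMulVec (f i) (star (e i)))).trace‖ := by
        conv_lhs => rw [hfe]
        rw [ampliate_apply_sum, Matrix.mul_sum, Matrix.trace_sum]
    _ ≤ ∑ i, c * (nrm (f i) * nrm (e i)) :=
        (norm_sum_le _ _).trans (Finset.sum_le_sum fun i _ => h k _ _ C hC)
    _ = c * traceNorm M := by rw [← Finset.mul_sum, hs]
    _ ≤ c := mul_le_of_le_one_right hc hM

theorem DBound.mono {Φ : Matrix X X ℂ →ₗ[ℂ] Matrix Y Y ℂ} {c d : ℝ}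
    (h : DBound Φ c) (hcd : c ≤ d) : DBound Φ d := fun k f e C hC =>
  (h k f e C hC).trans
    (mul_le_mul_of_nonneg_right hcd (mul_nonneg (nrm_nonneg _) (nrm_nonneg _)))

theorem dBound_zero : DBound (0 : Matrix X X ℂ →ₗ[ℂ] Matrix Y Y ℂ) 0 := fun k f e C _ => by
  have h : ampliate (0 : Matrix X X ℂ →ₗ[ℂ] Matrix Y Y ℂ) k (Matrix.vecMulVec f (star e)) = 0 := rfl
  simp [h]

theorem DBound.add {Φ Ψ : Matrix X X ℂ →ₗ[ℂ] Matrix Y Y ℂ} {c d : ℝ}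
    (h : DBound Φ c) (h' : DBound Ψ d) : DBound (Φ + Ψ) (c + d) := fun k f e C hC => by
  rw [ampliate_add, Matrix.mul_add, Matrix.trace_add, add_mul]
  exact (norm_add_le _ _).trans (add_le_add (h k f e C hC) (h' k f e C hC))

theorem DBound.smul {Φ : Matrix X X ℂ →ₗ[ℂ] Matrix Y Y ℂ} {c : ℝ}
    (h : DBound Φ c) (a : ℂ) : DBound (a • Φ) (‖a‖ * c) := fun k f e C hC => by
  rw [ampliate_smul, Matrix.mul_smul, Matrix.trace_smul, norm_smul, mul_assoc]
  exact mul_le_mul_of_nonneg_left (h k f e C hC) (norm_nonneg _)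

theorem DBound.sum {ι : Type} [Fintype ι] {Φ : ι → Matrix X X ℂ →ₗ[ℂ] Matrix Y Y ℂ} {c : ι → ℝ}
    (h : ∀ i, DBound (Φ i) (c i)) : DBound (∑ i, Φ i) (∑ i, c i) := fun k f e C hC => by
  rw [ampliate_sum, Matrix.mul_sum, Matrix.trace_sum, Finset.sum_mul]
  exact (norm_sum_le _ _).trans (Finset.sum_le_sum fun i _ => h i k f e C hC)

end Rank

/-! ### Stability of the rank-one bounds under instruments and perturbations -/

section Composition

variable [Fintype X] [DecidableEq X] [Fintype Y] [Fintype Z] [DecidableEq Z]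

theorem DBound.comp_conj {Φ : Matrix Y Y ℂ →ₗ[ℂ] Matrix Z Z ℂ} {c : ℝ} (hc : 0 ≤ c)
    (h : DBound Φ c) {K : Matrix Y X ℂ} (hK : ‖K‖ ≤ 1) : DBound (Φ ∘ₗ conj K) c := by
  intro k f e C hC
  rw [ampliate_comp_conj_vecMulVec]
  refine (h k _ _ C hC).trans ?_
  have hK' : ‖K ⊗ₖ (1 : Matrix (Fin k) (Fin k) ℂ)‖ ≤ 1 := (norm_kronecker_one_le K).trans hK
  have hb : ∀ g, nrm ((K ⊗ₖ (1 : Matrix (Fin k) (Fin k) ℂ)) *ᵥ g) ≤ nrm g := fun g =>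
    (nrm_mulVec_le _ g).trans (mul_le_of_le_one_left (nrm_nonneg _) hK')
  exact mul_le_mul_of_nonneg_left
    (mul_le_mul (hb f) (hb e) (nrm_nonneg _) (nrm_nonneg _)) hc

/-- Branching costs nothing. Completeness gives ∑ ‖K_i f‖² = ‖f‖², also with a reference system, and
Cauchy–Schwarz bounds ∑ ‖K_i f‖ ‖K_i e‖ by ‖f‖ ‖e‖, so the constant does not grow with the number of
outcomes. -/
theorem DBound.instrument {ι : Type} [Fintype ι] {Φ : ι → Matrix Y Y ℂ →ₗ[ℂ] Matrix Z Z ℂ} {c : ℝ}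
    (hc : 0 ≤ c) (h : ∀ i, DBound (Φ i) c) {K : ι → Matrix Y X ℂ}
    (hK : ∑ i, (K i)ᴴ * K i = 1) : DBound (∑ i, Φ i ∘ₗ conj (K i)) c := by
  intro k f e C hC
  rw [ampliate_sum, Matrix.mul_sum, Matrix.trace_sum]
  set L : ι → Matrix (Y × Fin k) (X × Fin k) ℂ := fun i => K i ⊗ₖ 1 with hL
  have hLc : ∑ i, (L i)ᴴ * L i = 1 := by
    have : ∀ i, (L i)ᴴ * L i = ((K i)ᴴ * K i) ⊗ₖ (1 : Matrix (Fin k) (Fin k) ℂ) := fun i => by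
      rw [hL, Matrix.conjTranspose_kronecker, ← Matrix.mul_kronecker_mul]
      simp
    rw [Finset.sum_congr rfl fun i _ => this i]
    have h2 := map_sum (AddMonoidHom.mk' (fun M : Matrix X X ℂ =>
      M ⊗ₖ (1 : Matrix (Fin k) (Fin k) ℂ)) fun A B => Matrix.add_kronecker A B 1)
      (fun i => (K i)ᴴ * K i) Finset.univ
    simp only [AddMonoidHom.mk'_apply] at h2
    rw [← h2, hK, Matrix.one_kronecker_one]
  have hb : ∀ i, ‖(C * ampliate (Φ i ∘ₗ conj (K i)) k (Matrix.vecMulVec f (star e))).trace‖ ≤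
      c * (nrm (L i *ᵥ f) * nrm (L i *ᵥ e)) := fun i => by
    rw [ampliate_comp_conj_vecMulVec]
    exact h i k _ _ C hC
  refine (norm_sum_le _ _).trans ((Finset.sum_le_sum fun i _ => hb i).trans ?_)
  rw [← Finset.mul_sum]
  refine mul_le_mul_of_nonneg_left ?_ hc
  have hcs := Finset.sum_mul_sq_le_sq_mul_sq Finset.univ (fun i => nrm (L i *ᵥ f))
    (fun i => nrm (L i *ᵥ e))
  rw [sum_nrm_sq_of_complete hLc, sum_nrm_sq_of_complete hLc, ← mul_pow] at hcs
  exact (abs_le_of_sq_le_sq hcs (mul_nonneg (nrm_nonneg _) (nrm_nonneg _))).trans' (le_abs_self _)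

theorem dBound_id : DBound (LinearMap.id : Matrix X X ℂ →ₗ[ℂ] Matrix X X ℂ) 1 := by
  intro k f e C hC
  have h : ampliate (LinearMap.id : Matrix X X ℂ →ₗ[ℂ] Matrix X X ℂ) k
      (Matrix.vecMulVec f (star e)) = Matrix.vecMulVec f (star e) := rfl
  rw [h, Matrix.mul_vecMulVec, Matrix.trace_vecMulVec, dotProduct_comm, one_mul,
    mul_comm (nrm f)]
  refine (norm_dotProduct_le _ _).trans (mul_le_mul_of_nonneg_left ?_ (nrm_nonneg _))
  exact (nrm_mulVec_le _ _).trans (mul_le_of_le_one_left (nrm_nonneg _) hC)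

/-- Replacing an operator `A` by a nearby one `B` changes the output by a small amount. -/
theorem DBound.comp_conj_sub_comp_conj {Φ : Matrix Y Y ℂ →ₗ[ℂ] Matrix Z Z ℂ} (h : DBound Φ 1)
    {A B : Matrix Y X ℂ} (hA : ‖A‖ ≤ 1) (hB : ‖B‖ ≤ 1) {δ : ℝ} (hAB : ‖A - B‖ ≤ δ) :
    DBound (Φ ∘ₗ conj A - Φ ∘ₗ conj B) (2 * δ) := by
  intro k f e C hC
  set A' : Matrix (Y × Fin k) (X × Fin k) ℂ := A ⊗ₖ 1 with hA'
  set B' : Matrix (Y × Fin k) (X × Fin k) ℂ := B ⊗ₖ 1 with hB'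
  have hd : A' - B' = (A - B) ⊗ₖ (1 : Matrix (Fin k) (Fin k) ℂ) := by
    rw [hA', hB', sub_eq_iff_eq_add, ← Matrix.add_kronecker, sub_add_cancel]
  have hdn : ∀ g, nrm (A' *ᵥ g - B' *ᵥ g) ≤ δ * nrm g := fun g => by
    rw [← Matrix.sub_mulVec, hd]
    exact (nrm_mulVec_le _ _).trans (mul_le_mul_of_nonneg_right
      ((norm_kronecker_one_le _).trans hAB) (nrm_nonneg _))
  have hAn : nrm (A' *ᵥ f) ≤ nrm f := (nrm_mulVec_le _ _).trans
    (mul_le_of_le_one_left (nrm_nonneg _) ((norm_kronecker_one_le _).trans hA))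
  have hBn : nrm (B' *ᵥ e) ≤ nrm e := (nrm_mulVec_le _ _).trans
    (mul_le_of_le_one_left (nrm_nonneg _) ((norm_kronecker_one_le _).trans hB))
  -- `A` is changed to `B` first on the bra and then on the ket. Each change costs δ, whence the
  -- factor 2.
  have hsplit : ampliate (Φ ∘ₗ conj A - Φ ∘ₗ conj B) k (Matrix.vecMulVec f (star e)) =
      ampliate Φ k (Matrix.vecMulVec (A' *ᵥ f) (star (A' *ᵥ e - B' *ᵥ e))) +
      ampliate Φ k (Matrix.vecMulVec (A' *ᵥ f - B' *ᵥ f) (star (B' *ᵥ e))) := by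
    rw [ampliate_sub, ampliate_comp_conj_vecMulVec, ampliate_comp_conj_vecMulVec, ← hA', ← hB',
      sub_eq_iff_eq_add, ← ampliate_apply_add, ← ampliate_apply_add]
    congr 1
    rw [star_sub, Matrix.vecMulVec_sub, Matrix.sub_vecMulVec]
    abel
  rw [hsplit, Matrix.mul_add, Matrix.trace_add]
  refine (norm_add_le _ _).trans ((add_le_add (h k _ _ C hC) (h k _ _ C hC)).trans ?_)
  have h1 : nrm (A' *ᵥ f) * nrm (A' *ᵥ e - B' *ᵥ e) ≤ nrm f * (δ * nrm e) :=
    mul_le_mul hAn (hdn e) (nrm_nonneg _) (nrm_nonneg _)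
  have h2 : nrm (A' *ᵥ f - B' *ᵥ f) * nrm (B' *ᵥ e) ≤ (δ * nrm f) * nrm e :=
    mul_le_mul (hdn f) hBn (nrm_nonneg _) ((nrm_nonneg _).trans (hdn f))
  linarith

end Composition

end Superoperators

/-! ### Query operators -/

section QueryOperators

variable {Q : Type} [Fintype Q] [DecidableEq Q]

theorem controlledOp_mul (A B : Matrix Q Q ℂ) :
    controlledOp A * controlledOp B = controlledOp (A * B) := by
  simp [controlledOp, Matrix.add_mul, Matrix.mul_add, ← Matrix.mul_kronecker_mul]

omit [Fintype Q] in
theorem controlledOp_conjTranspose (A : Matrix Q Q ℂ) :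
    (controlledOp A)ᴴ = controlledOp Aᴴ := by
  simp [controlledOp, Matrix.conjTranspose_kronecker]

omit [Fintype Q] in
theorem controlledOp_one : controlledOp (1 : Matrix Q Q ℂ) = 1 := by
  have h : Matrix.single false false (1 : ℂ) + Matrix.single true true (1 : ℂ) = 1 := by
    ext i j
    cases i <;> cases j <;> simp [Matrix.single]
  rw [controlledOp, ← Matrix.add_kronecker, h, Matrix.one_kronecker_one]

theorem QueryKind.op_conjTranspose_mul_op {U : Matrix Q Q ℂ} (hU : U ∈ Matrix.unitaryGroup Q ℂ)
    (kind : QueryKind) : (kind.op U)ᴴ * kind.op U = 1 := by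
  have h1 : Uᴴ * U = 1 := Matrix.mem_unitaryGroup_iff'.1 hU
  have h2 : U * Uᴴ = 1 := Matrix.mem_unitaryGroup_iff.1 hU
  cases kind <;>
    simp [QueryKind.op, controlledOp_conjTranspose, controlledOp_mul, controlledOp_one,
      Matrix.conjTranspose_kronecker, ← Matrix.mul_kronecker_mul, h1, h2]

/-- The operator on the whole memory that an operator on control qubit and query register
induces. -/
abbrev onMemory (w : ℕ) {X Y : Type} (A : Matrix (Bool × Y) (Bool × X) ℂ) :
    Matrix (Memory Y w) (Memory X w) ℂ := (1 : Matrix (Qubits w) (Qubits w) ℂ) ⊗ₖ A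

theorem onMemory_mul (w : ℕ) {X Y Z : Type} [Fintype Y]
    (A : Matrix (Bool × Z) (Bool × Y) ℂ) (B : Matrix (Bool × Y) (Bool × X) ℂ) :
    onMemory w A * onMemory w B = onMemory w (A * B) := by
  rw [onMemory, onMemory, ← Matrix.mul_kronecker_mul, Matrix.one_mul]

theorem onMemory_conjTranspose_mul_self (w : ℕ) {X Y : Type} [Fintype Y] [DecidableEq X]
    {A : Matrix (Bool × Y) (Bool × X) ℂ} (h : Aᴴ * A = 1) :
    (onMemory w A)ᴴ * onMemory w A = 1 := by
  rw [onMemory, Matrix.conjTranspose_kronecker, ← Matrix.mul_kronecker_mul, h]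
  simp

/-- Applying an operator to the query register and leaving the control qubit alone. -/
abbrev onQuery {X Y : Type} (J : Matrix Y X ℂ) : Matrix (Bool × Y) (Bool × X) ℂ :=
  (1 : Matrix Bool Bool ℂ) ⊗ₖ J

theorem onQuery_conjTranspose_mul_self {X Y : Type} [Fintype Y] [DecidableEq X]
    {J : Matrix Y X ℂ} (h : Jᴴ * J = 1) : (onQuery J)ᴴ * onQuery J = 1 := by
  rw [onQuery, Matrix.conjTranspose_kronecker, ← Matrix.mul_kronecker_mul, h]
  simp

theorem norm_unitary_le {U : Matrix Q Q ℂ} (hU : U ∈ Matrix.unitaryGroup Q ℂ) : ‖U‖ ≤ 1 :=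
  norm_isometry_le (Matrix.mem_unitaryGroup_iff'.1 hU)

theorem norm_single_true_kronecker_le {X Y : Type} [Fintype X] [DecidableEq X] [Fintype Y]
    [DecidableEq Y] (D : Matrix Y X ℂ) :
    ‖Matrix.single true true (1 : ℂ) ⊗ₖ D‖ ≤ ‖D‖ := by
  have h : Matrix.single true true (1 : ℂ) ⊗ₖ D =
      (Matrix.single true true (1 : ℂ) ⊗ₖ (1 : Matrix Y Y ℂ)) *
        ((1 : Matrix Bool Bool ℂ) ⊗ₖ D) := by
    rw [← Matrix.mul_kronecker_mul, Matrix.mul_one, Matrix.one_mul]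
  have hs : ‖Matrix.single true true (1 : ℂ)‖ ≤ 1 := by
    rw [← Matrix.diagonal_single, Matrix.l2_opNorm_diagonal]
    exact (pi_norm_le_iff_of_nonneg zero_le_one).2 fun i => by cases i <;> simp
  rw [h]
  refine (Matrix.l2_opNorm_mul _ _).trans ?_
  exact (mul_le_mul ((norm_kronecker_one_le _).trans hs) (norm_one_kronecker_le D)
    (norm_nonneg _) zero_le_one).trans_eq (one_mul _)

/-- If the isometry `J` nearly intertwines `U` and `G`, it nearly intertwines queries to them. -/
theorem QueryKind.norm_intertwine_le {X : Type} [Fintype X] [DecidableEq X]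
    {J : Matrix Q X ℂ} {U : Matrix X X ℂ} (hU : U ∈ Matrix.unitaryGroup X ℂ)
    {G : Matrix Q Q ℂ} (hG : G ∈ Matrix.unitaryGroup Q ℂ) (kind : QueryKind) :
    ‖onQuery J * kind.op U - kind.op G * onQuery J‖ ≤ ‖J * U - G * J‖ := by
  have hinv : ‖J * Uᴴ - Gᴴ * J‖ ≤ ‖J * U - G * J‖ := by
    have hU2 : U * Uᴴ = 1 := Matrix.mem_unitaryGroup_iff.1 hU
    have hG1 : Gᴴ * G = 1 := Matrix.mem_unitaryGroup_iff'.1 hG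
    -- The defect for the inverses is the defect for `U` and `G` multiplied by contractions on both
    -- sides.
    have h : J * Uᴴ - Gᴴ * J = -(Gᴴ * (J * U - G * J) * Uᴴ) := by
      rw [Matrix.mul_sub, Matrix.sub_mul, ← Matrix.mul_assoc Gᴴ G, hG1, Matrix.one_mul,
        Matrix.mul_assoc Gᴴ, Matrix.mul_assoc J, hU2, Matrix.mul_one, neg_sub]
    have hUn : ‖Uᴴ‖ ≤ 1 := by
      rw [Matrix.l2_opNorm_conjTranspose]; exact norm_unitary_le hU
    have hGn : ‖Gᴴ‖ ≤ 1 := by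
      rw [Matrix.l2_opNorm_conjTranspose]; exact norm_unitary_le hG
    rw [h, norm_neg]
    refine (Matrix.l2_opNorm_mul _ _).trans
      ((mul_le_of_le_one_right (norm_nonneg _) hUn).trans ?_)
    exact (Matrix.l2_opNorm_mul _ _).trans (mul_le_of_le_one_left (norm_nonneg _) hGn)
  have hplain : ∀ (A : Matrix X X ℂ) (B : Matrix Q Q ℂ),
      ‖onQuery J * ((1 : Matrix Bool Bool ℂ) ⊗ₖ A) - ((1 : Matrix Bool Bool ℂ) ⊗ₖ B) * onQuery J‖
        ≤ ‖J * A - B * J‖ := fun A B => by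
    rw [onQuery, ← Matrix.mul_kronecker_mul, ← Matrix.mul_kronecker_mul, Matrix.one_mul]
    have : (1 : Matrix Bool Bool ℂ) ⊗ₖ (J * A) - (1 : Matrix Bool Bool ℂ) ⊗ₖ (B * J)
        = (1 : Matrix Bool Bool ℂ) ⊗ₖ (J * A - B * J) := by
      rw [sub_eq_iff_eq_add, ← Matrix.kronecker_add, sub_add_cancel]
    rw [this]
    exact norm_one_kronecker_le _
  have hctrl : ∀ (A : Matrix X X ℂ) (B : Matrix Q Q ℂ),
      ‖onQuery J * controlledOp A - controlledOp B * onQuery J‖ ≤ ‖J * A - B * J‖ := fun A B => by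
    -- When the control is 0 both terms act as `J`, so only the block with control 1 survives.
    have : onQuery J * controlledOp A - controlledOp B * onQuery J
        = Matrix.single true true (1 : ℂ) ⊗ₖ (J * A - B * J) := by
      rw [onQuery, controlledOp, controlledOp, Matrix.mul_add, Matrix.add_mul]
      simp only [← Matrix.mul_kronecker_mul, Matrix.one_mul, Matrix.mul_one]
      rw [add_sub_add_left_eq_sub, sub_eq_iff_eq_add, ← Matrix.kronecker_add, sub_add_cancel]
    rw [this]
    exact norm_single_true_kronecker_le _
  cases kind with
  | plain => exact hplain U G
  | inverse => exact (hplain _ _).trans hinv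
  | controlled => exact hctrl U G
  | controlledInverse => exact (hctrl _ _).trans hinv

/-- The part of a query of the given kind to `O S O R` that precedes the first query to `O`. -/
def QueryKind.before (R : Matrix Q Q ℂ) : QueryKind → Matrix (Bool × Q) (Bool × Q) ℂ
  | plain => plain.op R
  | inverse => 1
  | controlled => controlled.op R
  | controlledInverse => 1

/-- The part of a query of the given kind to `O S O R` that follows the last query to `O`. -/
def QueryKind.after (R : Matrix Q Q ℂ) : QueryKind → Matrix (Bool × Q) (Bool × Q) ℂ
  | plain => 1
  | inverse => inverse.op R
  | controlled => 1
  | controlledInverse => controlledInverse.op R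

theorem QueryKind.before_complete {R : Matrix Q Q ℂ} (hR : R ∈ Matrix.unitaryGroup Q ℂ)
    (kind : QueryKind) : (kind.before R)ᴴ * kind.before R = 1 := by
  cases kind
  · exact QueryKind.op_conjTranspose_mul_op hR _
  · simp [before]
  · exact QueryKind.op_conjTranspose_mul_op hR _
  · simp [before]

theorem QueryKind.after_complete {R : Matrix Q Q ℂ} (hR : R ∈ Matrix.unitaryGroup Q ℂ)
    (kind : QueryKind) : (kind.after R)ᴴ * kind.after R = 1 := by
  cases kind
  · simp [after]
  · exact QueryKind.op_conjTranspose_mul_op hR _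
  · simp [after]
  · exact QueryKind.op_conjTranspose_mul_op hR _

/-- Taking adjoints reverses O S O R but keeps its palindromic part O S O in shape. Hence `R` is
applied before the two oracle calls for forward queries and after them for inverse queries, and both
calls have the kind of the simulated query. -/
theorem QueryKind.op_sandwich (O S R : Matrix Q Q ℂ) (kind : QueryKind) :
    kind.after R * (kind.op O * (kind.op S * (kind.op O * kind.before R))) =
      kind.op (O * S * O * R) := by
  cases kind <;>
    simp [after, before, op, controlledOp_mul, ← Matrix.mul_kronecker_mul, Matrix.mul_assoc]

end QueryOperators

/-! ### Contractivity of programs and the hybrid bound -/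

section Programs

variable {Q : Type} [Fintype Q] [DecidableEq Q] {b : ℕ}

theorem Program.dBound_run {U : Matrix Q Q ℂ} (hU : U ∈ Matrix.unitaryGroup Q ℂ) {w T : ℕ}
    (P : Program Q b w T) : DBound (P.run U) 1 := by
  induction P with
  | output K hK =>
    have h := DBound.instrument zero_le_one (fun _ => dBound_id) hK
    exact h
  | instrument K hK next ih => exact DBound.instrument zero_le_one ih hK
  | @query w T kind next ih =>
    exact ih.comp_conj zero_le_one (norm_isometry_le
      (onMemory_conjTranspose_mul_self w (QueryKind.op_conjTranspose_mul_op hU kind)))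

end Programs

/-! ### Simulating the queries of a program by queries to another unitary -/

section Simulation

variable {Q : Type} [Fintype Q] [DecidableEq Q] {b : ℕ}

/-- An instrument whose outcomes are indexed by an arbitrary finite type. -/
def Program.instrumentOf {w w' T : ℕ} {ι : Type} [Fintype ι]
    (K : ι → Matrix (Memory Q w') (Memory Q w) ℂ) (hK : ∑ i, (K i)ᴴ * K i = 1)
    (next : ι → Program Q b w' T) : Program Q b w T :=
  .instrument (fun j => K ((Fintype.equivFin ι).symm j))
    (by rw [← hK]; exact (Fintype.equivFin ι).symm.sum_comp fun i => (K i)ᴴ * K i)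
    (fun j => next ((Fintype.equivFin ι).symm j))

theorem Program.run_instrumentOf {w w' T : ℕ} {ι : Type} [Fintype ι]
    (K : ι → Matrix (Memory Q w') (Memory Q w) ℂ) (hK : ∑ i, (K i)ᴴ * K i = 1)
    (next : ι → Program Q b w' T) (U : Matrix Q Q ℂ) :
    (Program.instrumentOf K hK next).run U = ∑ i, (next i).run U ∘ₗ conj (K i) :=
  (Fintype.equivFin ι).symm.sum_comp fun i => (next i).run U ∘ₗ conj (K i)

/-- Final measurement whose outcomes are indexed by an arbitrary finite type. -/
def Program.outputOf {w : ℕ} {ι : Type} [Fintype ι]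
    (K : ι → Matrix (Qubits b) (Memory Q w) ℂ) (hK : ∑ i, (K i)ᴴ * K i = 1) : Program Q b w 0 :=
  .output (fun j => K ((Fintype.equivFin ι).symm j))
    (by rw [← hK]; exact (Fintype.equivFin ι).symm.sum_comp fun i => (K i)ᴴ * K i)

theorem Program.run_outputOf {w : ℕ} {ι : Type} [Fintype ι]
    (K : ι → Matrix (Qubits b) (Memory Q w) ℂ) (hK : ∑ i, (K i)ᴴ * K i = 1) (U : Matrix Q Q ℂ) :
    (Program.outputOf K hK).run U = ∑ i, conj (K i) :=
  (Fintype.equivFin ι).symm.sum_comp fun i => conj (K i)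

/-- Application of one isometry. -/
def Program.gate {w T : ℕ} (K : Matrix (Memory Q w) (Memory Q w) ℂ) (hK : Kᴴ * K = 1)
    (next : Program Q b w T) : Program Q b w T :=
  .instrument (r := 1) (fun _ => K) (by simpa using hK) fun _ => next

theorem Program.run_gate {w T : ℕ} (K : Matrix (Memory Q w) (Memory Q w) ℂ) (hK : Kᴴ * K = 1)
    (next : Program Q b w T) (U : Matrix Q Q ℂ) :
    (Program.gate K hK next).run U = next.run U ∘ₗ conj K := by
  simp [Program.gate, Program.run]

/-- Two queries of the given kind that together act as a query to `O S O R`, where `O` is the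
oracle. -/
def Program.sandwich {w m m' : ℕ} (h : m' = m + 1 + 1) (kind : QueryKind) {S R : Matrix Q Q ℂ}
    (hS : S ∈ Matrix.unitaryGroup Q ℂ) (hR : R ∈ Matrix.unitaryGroup Q ℂ)
    (next : Program Q b w m) : Program Q b w m' :=
  -- The cast by `h` allows the query count to be given as 2(T + 1) instead of 2T + 1 + 1.
  h ▸ .gate (onMemory w (kind.before R))
    (onMemory_conjTranspose_mul_self w (kind.before_complete hR))
    (.query kind
      (.gate (onMemory w (kind.op S))
        (onMemory_conjTranspose_mul_self w (kind.op_conjTranspose_mul_op hS))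
        (.query kind
          (.gate (onMemory w (kind.after R))
            (onMemory_conjTranspose_mul_self w (kind.after_complete hR)) next))))

theorem Program.run_query {w m : ℕ} (kind : QueryKind) (next : Program Q b w m)
    (O : Matrix Q Q ℂ) :
    (Program.query kind next).run O = next.run O ∘ₗ conj (onMemory w (kind.op O)) := by
  rw [Program.run]

theorem QueryKind.conj_op_sandwich (w : ℕ) (O S R : Matrix Q Q ℂ) (kind : QueryKind) :
    conj (onMemory w (kind.op (O * S * O * R))) =
      conj (onMemory w (kind.after R)) ∘ₗ conj (onMemory w (kind.op O)) ∘ₗ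
        conj (onMemory w (kind.op S)) ∘ₗ conj (onMemory w (kind.op O)) ∘ₗ
          conj (onMemory w (kind.before R)) := by
  rw [← QueryKind.op_sandwich]
  simp only [conj_comp_conj, onMemory_mul]

theorem Program.run_sandwich {w m m' : ℕ} (h : m' = m + 1 + 1) (kind : QueryKind)
    {S R : Matrix Q Q ℂ} (hS : S ∈ Matrix.unitaryGroup Q ℂ) (hR : R ∈ Matrix.unitaryGroup Q ℂ)
    (next : Program Q b w m) (O : Matrix Q Q ℂ) :
    (Program.sandwich h kind hS hR next).run O =
      next.run O ∘ₗ conj (onMemory w (kind.op (O * S * O * R))) := by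
  subst h
  rw [Program.sandwich, Program.run_gate, Program.run_query, Program.run_gate, Program.run_query,
    Program.run_gate, QueryKind.conj_op_sandwich, LinearMap.comp_assoc, LinearMap.comp_assoc,
    LinearMap.comp_assoc, LinearMap.comp_assoc]

/-! ### Transport of instruments along isometries -/

/-- Given an isometry `J`, an operator family that discards the complement of the range of `J`
and replaces it by the basis state `y`. -/
def discard {X X' Y : Type} [Fintype X] [DecidableEq X'] [DecidableEq Y]
    (J : Matrix X' X ℂ) [Fintype X'] (y : Y) (m : X') : Matrix Y X' ℂ :=
  Matrix.single y m (1 : ℂ) * (1 - J * Jᴴ)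

section Discard

variable {X X' Y Y' : Type} [Fintype X] [DecidableEq X] [Fintype X'] [DecidableEq X'] [Fintype Y]
  [DecidableEq Y']

theorem discard_mul {J : Matrix X' X ℂ} (hJ : Jᴴ * J = 1) (y : Y') (m : X') :
    discard J y m * J = 0 := by
  rw [discard, Matrix.mul_assoc, Matrix.sub_mul, Matrix.one_mul, Matrix.mul_assoc, hJ,
    Matrix.mul_one, sub_self, Matrix.mul_zero]

theorem discard_complete [Fintype Y'] {J : Matrix X' X ℂ} (hJ : Jᴴ * J = 1) (y : Y') :
    ∑ m, (discard J y m)ᴴ * discard J y m = 1 - J * Jᴴ := by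
  have h1 : (1 - J * Jᴴ)ᴴ = 1 - J * Jᴴ := by simp
  have h2 : (1 - J * Jᴴ) * (1 - J * Jᴴ) = 1 - J * Jᴴ := by
    have : J * Jᴴ * (J * Jᴴ) = J * Jᴴ := by
      rw [Matrix.mul_assoc, ← Matrix.mul_assoc Jᴴ, hJ, Matrix.one_mul]
    rw [Matrix.mul_sub, Matrix.mul_one, Matrix.sub_mul, Matrix.one_mul, this, sub_self, sub_zero]
  have h3 : ∀ m, (discard J y m)ᴴ * discard J y m =
      (1 - J * Jᴴ) * Matrix.single m m (1 : ℂ) * (1 - J * Jᴴ) := fun m => by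
    rw [discard, Matrix.conjTranspose_mul, h1, Matrix.conjTranspose_single]
    simp only [Matrix.mul_assoc]
    rw [← Matrix.mul_assoc (Matrix.single m y _), Matrix.single_mul_single_same]
    simp
  have h4 : ∑ m : X', Matrix.single m m (1 : ℂ) = 1 := by
    ext i j
    simp [Matrix.sum_apply, Matrix.single, Matrix.one_apply, ite_and]
  rw [Finset.sum_congr rfl fun m _ => h3 m, ← Matrix.sum_mul, ← Matrix.mul_sum, h4,
    Matrix.mul_one, h2]

/-- A complete family of operators between the domains of two isometries, transported to their
codomains and completed. -/
def transport (J : Matrix X' X ℂ) (J' : Matrix Y' Y ℂ) (y : Y') {r : ℕ}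
    (K : Fin r → Matrix Y X ℂ) : Fin r ⊕ X' → Matrix Y' X' ℂ :=
  Sum.elim (fun i => J' * K i * Jᴴ) (discard J y)

/-- The transported operators sum only to the projection JJ† onto the range; the discarding outcomes
supply 1 - JJ†. These extra outcomes are zero on the range, so they never occur in a simulation. -/
theorem transport_complete [DecidableEq Y] [Fintype Y'] {J : Matrix X' X ℂ} {J' : Matrix Y' Y ℂ} (hJ : Jᴴ * J = 1)
    (hJ' : J'ᴴ * J' = 1) (y : Y') {r : ℕ} {K : Fin r → Matrix Y X ℂ}
    (hK : ∑ i, (K i)ᴴ * K i = 1) :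
    ∑ i, (transport J J' y K i)ᴴ * transport J J' y K i = 1 := by
  rw [Fintype.sum_sum_type]
  have h : ∀ i, (transport J J' y K (Sum.inl i))ᴴ * transport J J' y K (Sum.inl i) =
      J * ((K i)ᴴ * K i) * Jᴴ := fun i => by
    simp only [transport, Sum.elim_inl, Matrix.conjTranspose_mul, Matrix.conjTranspose_conjTranspose,
      Matrix.mul_assoc]
    rw [← Matrix.mul_assoc J'ᴴ, hJ', Matrix.one_mul]
  rw [Finset.sum_congr rfl fun i _ => h i, ← Matrix.sum_mul, ← Matrix.mul_sum, hK, Matrix.mul_one]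
  simp only [transport, Sum.elim_inr]
  rw [discard_complete hJ, add_sub_cancel]

theorem transport_inl_mul {J : Matrix X' X ℂ} {J' : Matrix Y' Y ℂ} (hJ : Jᴴ * J = 1)
    (y : Y') {r : ℕ} (K : Fin r → Matrix Y X ℂ) (i : Fin r) :
    transport J J' y K (Sum.inl i) * J = J' * K i := by
  rw [transport, Sum.elim_inl, Matrix.mul_assoc, hJ, Matrix.mul_one]

theorem transport_inr_mul {J : Matrix X' X ℂ} {J' : Matrix Y' Y ℂ} (hJ : Jᴴ * J = 1)
    (y : Y') {r : ℕ} (K : Fin r → Matrix Y X ℂ) (m : X') :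
    transport J J' y K (Sum.inr m) * J = 0 := discard_mul hJ y m

end Discard

/-- A program that makes `T` queries and outputs zeros. -/
def Program.idle (Q : Type) [Fintype Q] [DecidableEq Q] (b w : ℕ) : (T : ℕ) → Program Q b w T
  -- With an empty domain the isometry has range 0, so the whole memory is discarded.
  | 0 => Program.outputOf (transport (X := Empty) (Y := Empty) (r := 0)
      (0 : Matrix (Memory Q w) Empty ℂ) (0 : Matrix (Qubits b) Empty ℂ) (zeroString b)
      (fun _ => 0)) (transport_complete (Subsingleton.elim _ _) (Subsingleton.elim _ _) _
        (Subsingleton.elim _ _))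
  | T + 1 => .query .plain (Program.idle Q b w T)

/-- The embedding of the memory induced by an embedding of the query register. -/
abbrev memoryEmbedding {X : Type} (J : Matrix Q X ℂ) (w : ℕ) : Matrix (Memory Q w) (Memory X w) ℂ :=
  onMemory w (onQuery J)

omit [DecidableEq Q] in
theorem memoryEmbedding_isometry {X : Type} [Fintype X] [DecidableEq X] {J : Matrix Q X ℂ}
    (hJ : Jᴴ * J = 1) (w : ℕ) : (memoryEmbedding J w)ᴴ * memoryEmbedding J w = 1 :=
  onMemory_conjTranspose_mul_self w (onQuery_conjTranspose_mul_self hJ)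

variable {X : Type} [Fintype X] [DecidableEq X]

/-- Runs a program with query register `X` on an embedded register, with each query
replaced by a query of the same kind to `O S O R`, where `O` is the oracle. -/
def Program.simulate (J : Matrix Q X ℂ) (hJ : Jᴴ * J = 1) (q : Q) (S R : Matrix Q Q ℂ)
    (hS : S ∈ Matrix.unitaryGroup Q ℂ) (hR : R ∈ Matrix.unitaryGroup Q ℂ) :
    {w T : ℕ} → Program X b w T → Program Q b w (2 * T)
  | w, _, .output K hK =>
      .outputOf (transport (memoryEmbedding J w) 1 (zeroString b) K)
        (transport_complete (memoryEmbedding_isometry hJ w) (by simp) _ hK)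
  | w, _, .instrument (w' := w') (T := T) K hK next =>
      .instrumentOf
        (transport (memoryEmbedding J w) (memoryEmbedding J w') (zeroString w', false, q) K)
        (transport_complete (memoryEmbedding_isometry hJ w) (memoryEmbedding_isometry hJ w') _ hK)
        (Sum.elim (fun i => (next i).simulate J hJ q S R hS hR)
          -- The branches outside the encoded space must still make 2T queries to have the right
          -- type.
          (fun _ => Program.idle Q b w' (2 * T)))
  | w, _, .query (T := T) kind next =>
      .sandwich (Nat.mul_succ 2 T) kind hS hR (next.simulate J hJ q S R hS hR)

theorem sum_comp {ι M N L : Type} [Fintype ι] [AddCommMonoid M] [AddCommMonoid N] [AddCommMonoid L]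
    [Module ℂ M] [Module ℂ N] [Module ℂ L] (Φ : ι → N →ₗ[ℂ] L) (Ψ : M →ₗ[ℂ] N) :
    (∑ i, Φ i) ∘ₗ Ψ = ∑ i, Φ i ∘ₗ Ψ := by
  ext x
  simp

section RunSimulate

variable (J : Matrix Q X ℂ) (hJ : Jᴴ * J = 1) (q : Q) (O S R : Matrix Q Q ℂ)
  (hS : S ∈ Matrix.unitaryGroup Q ℂ) (hR : R ∈ Matrix.unitaryGroup Q ℂ)

theorem Program.run_simulate_output {w r : ℕ} (K : Fin r → Matrix (Qubits b) (Memory X w) ℂ)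
    (hK : ∑ i, (K i)ᴴ * K i = 1) :
    ((Program.output K hK).simulate J hJ q S R hS hR).run O ∘ₗ conj (memoryEmbedding J w) =
      ∑ i, conj (K i) := by
  rw [Program.simulate, Program.run_outputOf, sum_comp, Fintype.sum_sum_type]
  simp only [conj_comp_conj, transport_inl_mul (memoryEmbedding_isometry hJ w),
    transport_inr_mul (memoryEmbedding_isometry hJ w), conj_zero, Matrix.one_mul,
    Finset.sum_const_zero, add_zero]

theorem Program.run_simulate_instrument {w w' r T : ℕ}
    (K : Fin r → Matrix (Memory X w') (Memory X w) ℂ)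
    (hK : ∑ i, (K i)ᴴ * K i = 1) (next : Fin r → Program X b w' T) :
    ((Program.instrument K hK next).simulate J hJ q S R hS hR).run O ∘ₗ
        conj (memoryEmbedding J w) =
      ∑ i, (((next i).simulate J hJ q S R hS hR).run O ∘ₗ conj (memoryEmbedding J w')) ∘ₗ
        conj (K i) := by
  rw [Program.simulate, Program.run_instrumentOf, sum_comp, Fintype.sum_sum_type]
  simp only [LinearMap.comp_assoc, conj_comp_conj,
    transport_inl_mul (memoryEmbedding_isometry hJ w),
    transport_inr_mul (memoryEmbedding_isometry hJ w), conj_zero, LinearMap.comp_zero,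
    Finset.sum_const_zero, add_zero, Sum.elim_inl]

theorem Program.run_simulate_query {w T : ℕ} (kind : QueryKind) (next : Program X b w T) :
    ((Program.query kind next).simulate J hJ q S R hS hR).run O =
      (next.simulate J hJ q S R hS hR).run O ∘ₗ conj (onMemory w (kind.op (O * S * O * R))) := by
  rw [Program.simulate, Program.run_sandwich]

end RunSimulate

/-- Hybrid argument by induction on the program. Instruments are simulated exactly on the embedded
memory, and each query adds 2δ: δ for the ket and δ for the bra. -/
theorem Program.dBound_run_sub_simulate {J : Matrix Q X ℂ} (hJ : Jᴴ * J = 1) (q : Q)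
    {O S R : Matrix Q Q ℂ} (hO : O ∈ Matrix.unitaryGroup Q ℂ)
    (hS : S ∈ Matrix.unitaryGroup Q ℂ) (hR : R ∈ Matrix.unitaryGroup Q ℂ)
    {U : Matrix X X ℂ} (hU : U ∈ Matrix.unitaryGroup X ℂ) {δ : ℝ}
    (hδ : ‖J * U - O * S * O * R * J‖ ≤ δ) {w T : ℕ} (P : Program X b w T) :
    DBound (P.run U - (P.simulate J hJ q S R hS hR).run O ∘ₗ conj (memoryEmbedding J w))
      (2 * T * δ) := by
  have hδ0 : 0 ≤ δ := (norm_nonneg _).trans hδ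
  have hG : O * S * O * R ∈ Matrix.unitaryGroup Q ℂ := mul_mem (mul_mem (mul_mem hO hS) hO) hR
  induction P with
  | @output w r K hK =>
    rw [Program.run_simulate_output, Program.run, sub_self]
    exact dBound_zero.mono (by positivity)
  | @instrument w w' r T K hK next ih =>
    rw [Program.run_simulate_instrument, Program.run, ← Finset.sum_sub_distrib]
    simp only [← LinearMap.sub_comp]
    exact DBound.instrument (by positivity) ih hK
  | @query w T kind next ih =>
    set Φ := (next.simulate J hJ q S R hS hR).run O with hΦ
    -- The first term is the error of the remaining program after an exact query. The second is the
    -- failure of the embedding to intertwine this one query.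
    have h : (Program.query kind next).run U -
        ((Program.query kind next).simulate J hJ q S R hS hR).run O ∘ₗ
          conj (memoryEmbedding J w) =
        (next.run U - Φ ∘ₗ conj (memoryEmbedding J w)) ∘ₗ conj (onMemory w (kind.op U)) +
        (Φ ∘ₗ conj (memoryEmbedding J w * onMemory w (kind.op U)) -
          Φ ∘ₗ conj (onMemory w (kind.op (O * S * O * R)) * memoryEmbedding J w)) := by
      rw [Program.run_simulate_query, Program.run_query, LinearMap.sub_comp]
      simp only [LinearMap.comp_assoc, conj_comp_conj]
      abel
    rw [h]
    have hmem := memoryEmbedding_isometry hJ w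
    have hopU := onMemory_conjTranspose_mul_self w (kind.op_conjTranspose_mul_op hU)
    have hopG := onMemory_conjTranspose_mul_self w (kind.op_conjTranspose_mul_op hG)
    have h1 := ih.comp_conj (by positivity) (norm_isometry_le hopU)
    have h3 : ‖memoryEmbedding J w * onMemory w (kind.op U) -
        onMemory w (kind.op (O * S * O * R)) * memoryEmbedding J w‖ ≤ δ := by
      rw [memoryEmbedding, onMemory_mul, onMemory_mul]
      have : onMemory w (onQuery J * kind.op U) - onMemory w (kind.op (O * S * O * R) * onQuery J)
          = onMemory w (onQuery J * kind.op U - kind.op (O * S * O * R) * onQuery J) := by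
        rw [onMemory, onMemory, sub_eq_iff_eq_add, ← Matrix.kronecker_add, sub_add_cancel]
      rw [this]
      exact (norm_one_kronecker_le _).trans ((kind.norm_intertwine_le hU hG).trans hδ)
    have h4 := (Program.dBound_run hO (next.simulate J hJ q S R hS hR)).comp_conj_sub_comp_conj
      ((Matrix.l2_opNorm_mul _ _).trans
        (mul_le_one₀ (norm_isometry_le hmem) (norm_nonneg _) (norm_isometry_le hopU)))
      ((Matrix.l2_opNorm_mul _ _).trans
        (mul_le_one₀ (norm_isometry_le hopG) (norm_nonneg _) (norm_isometry_le hmem))) h3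
    exact (h1.add h4).mono (by push_cast; linarith)

end Simulation

/-! ### Reflections and the unitary that exchanges two states -/

section Reflections

variable {X : Type} [Fintype X] [DecidableEq X]

theorem nrm_isometry_mulVec {Q : Type} [Fintype Q] {J : Matrix Q X ℂ}
    (hJ : Jᴴ * J = 1) (f : X → ℂ) : nrm (J *ᵥ f) = nrm f := by
  have h := sum_nrm_sq_of_complete (ι := Unit) (K := fun _ => J) (by simpa using hJ) f
  simp only [Finset.univ_unique, Finset.sum_const, Finset.card_singleton, one_smul] at h
  exact (pow_left_inj₀ (nrm_nonneg _) (nrm_nonneg _) two_ne_zero).1 h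

/-- The operator `1 - c |w⟩⟨w|`. -/
def rankOneUpdate (c : ℂ) (w : X → ℂ) : Matrix X X ℂ := 1 - c • Matrix.vecMulVec w (star w)

theorem rankOneUpdate_mulVec (c : ℂ) (w f : X → ℂ) :
    rankOneUpdate c w *ᵥ f = f - (c * (star w ⬝ᵥ f)) • w := by
  rw [rankOneUpdate, Matrix.sub_mulVec, Matrix.one_mulVec, Matrix.smul_mulVec,
    Matrix.vecMulVec_mulVec, op_smul_eq_smul, smul_smul]

/-- Since |w⟩⟨w| squares to ‖w‖²|w⟩⟨w|, the hypothesis is exactly what cancels the rank-one terms of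
(1 - c̄|w⟩⟨w|)(1 - c|w⟩⟨w|). -/
theorem rankOneUpdate_mem_unitaryGroup {c : ℂ} {w : X → ℂ}
    (h : c + star c = star c * c * (star w ⬝ᵥ w)) :
    rankOneUpdate c w ∈ Matrix.unitaryGroup X ℂ := by
  rw [Matrix.mem_unitaryGroup_iff', Matrix.star_eq_conjTranspose]
  have h1 : (rankOneUpdate c w)ᴴ = 1 - star c • Matrix.vecMulVec w (star w) := by
    simp [rankOneUpdate, Matrix.conjTranspose_vecMulVec]
  rw [h1, rankOneUpdate, Matrix.sub_mul, Matrix.one_mul, Matrix.mul_sub, Matrix.mul_one,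
    Matrix.smul_mul, Matrix.mul_smul, Matrix.vecMulVec_mul_vecMulVec]
  ext i j
  simp only [Matrix.sub_apply, Matrix.smul_apply, Matrix.vecMulVec_apply, Pi.smul_apply,
    smul_eq_mul, Pi.star_apply]
  linear_combination (-(w i * star (w j))) * h

omit [Fintype X] in
theorem reflection_eq (χ : X → ℂ) : reflection χ = rankOneUpdate 2 χ := rfl

theorem reflection_mem_unitaryGroup {χ : X → ℂ} (hχ : IsState χ) :
    reflection χ ∈ Matrix.unitaryGroup X ℂ := by
  rw [reflection_eq]
  apply rankOneUpdate_mem_unitaryGroup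
  rw [hχ]
  simp
  norm_num

omit [Fintype X] in
theorem reflection_conjTranspose (χ : X → ℂ) : (reflection χ)ᴴ = reflection χ := by
  simp [reflection, Matrix.conjTranspose_vecMulVec]

/-- A unitary that maps a given state `φ` to a given state `ψ`, with a correction for
the phase of `⟨ψ|φ⟩`. -/
def exchange (φ ψ : X → ℂ) : Matrix X X ℂ :=
  rankOneUpdate (1 - star ψ ⬝ᵥ φ)⁻¹ (φ - ψ)

variable {φ ψ : X → ℂ}

omit [DecidableEq X] in
theorem star_dotProduct_comm (φ ψ : X → ℂ) : star φ ⬝ᵥ ψ = star (star ψ ⬝ᵥ φ) := by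
  rw [Matrix.star_dotProduct]

omit [DecidableEq X] in
theorem star_sub_dotProduct_sub (hφ : IsState φ) (hψ : IsState ψ) :
    star (φ - ψ) ⬝ᵥ (φ - ψ) = (1 - star ψ ⬝ᵥ φ) + star (1 - star ψ ⬝ᵥ φ) := by
  rw [star_sub, sub_dotProduct, dotProduct_sub, dotProduct_sub, hφ, hψ, star_dotProduct_comm φ ψ]
  simp
  ring

omit [DecidableEq X] in
theorem eq_of_dotProduct_eq_one (hφ : IsState φ) (hψ : IsState ψ) (h : 1 - star ψ ⬝ᵥ φ = 0) :
    φ = ψ := by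
  have h2 := star_sub_dotProduct_sub hφ hψ
  rw [h] at h2
  have h3 : star (φ - ψ) ⬝ᵥ (φ - ψ) = 0 := by simpa using h2
  rw [star_dotProduct_self] at h3
  have h4 : nrm (φ - ψ) = 0 := by simpa using h3
  have h5 : WithLp.toLp 2 (φ - ψ) = 0 := norm_eq_zero.1 h4
  exact sub_eq_zero.1 (congrArg WithLp.ofLp h5)

theorem exchange_mulVec (hφ : IsState φ) (hψ : IsState ψ) : exchange φ ψ *ᵥ φ = ψ := by
  rw [exchange, rankOneUpdate_mulVec]
  -- In the degenerate case φ = ψ and the exchange is the identity. Otherwise its coefficient is the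
  -- inverse of ⟨φ - ψ|φ⟩, so exactly φ - ψ is subtracted from φ.
  by_cases h : 1 - star ψ ⬝ᵥ φ = 0
  · rw [eq_of_dotProduct_eq_one hφ hψ h]; simp
  · have : star (φ - ψ) ⬝ᵥ φ = 1 - star ψ ⬝ᵥ φ := by rw [star_sub, sub_dotProduct, hφ]
    rw [this, inv_mul_cancel₀ h]
    simp

/-- With z = 1 - ⟨ψ|φ⟩ one has ‖φ - ψ‖² = z + z̄, so the unitarity condition for c = 1/z reads 1/z +
1/z̄ = (z + z̄)/|z|². -/
theorem exchange_mem_unitaryGroup (hφ : IsState φ) (hψ : IsState ψ) :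
    exchange φ ψ ∈ Matrix.unitaryGroup X ℂ := by
  apply rankOneUpdate_mem_unitaryGroup
  rw [star_sub_dotProduct_sub hφ hψ]
  set z := 1 - star ψ ⬝ᵥ φ
  by_cases h : z = 0
  · simp [h]
  · have h' : star z ≠ 0 := star_ne_zero.2 h
    rw [star_inv₀]
    field_simp
    ring

end Reflections

/-! ### Operator norm error of one simulated query -/

section Estimate

variable {n : ℕ} {Q : Type} [Fintype Q] [DecidableEq Q] (E : Encoding n Q)

theorem Encoding.bot_dotProduct (ψ : Qubits n → ℂ) : star E.bot ⬝ᵥ (E.J *ᵥ ψ) = 0 :=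
  E.bot_orthogonal ψ

theorem Encoding.dotProduct_bot (ψ : Qubits n → ℂ) : star (E.J *ᵥ ψ) ⬝ᵥ E.bot = 0 := by
  rw [star_dotProduct_comm, E.bot_orthogonal, star_zero]

theorem Encoding.dotProduct_J (φ ψ : Qubits n → ℂ) :
    star (E.J *ᵥ φ) ⬝ᵥ (E.J *ᵥ ψ) = star φ ⬝ᵥ ψ := by
  rw [Matrix.star_mulVec, Matrix.dotProduct_mulVec, Matrix.vecMul_vecMul, E.isometry,
    Matrix.vecMul_one]

theorem Encoding.conjTranspose_mulVec_bot : E.Jᴴ *ᵥ E.bot = 0 := by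
  have h : ∀ ψ, (star E.bot ᵥ* E.J) ⬝ᵥ ψ = 0 := fun ψ => by
    rw [← Matrix.dotProduct_mulVec]; exact E.bot_orthogonal ψ
  have h2 : star E.bot ᵥ* E.J = 0 := dotProduct_eq_zero _ h
  have h3 := congrArg star h2
  rwa [Matrix.star_vecMul, star_star, star_zero] at h3

/-- The state `(|ψ⟩ - |⊥⟩) / √2` about which the canonical oracle reflects. -/
abbrev Encoding.axis (ψ : Qubits n → ℂ) : Q → ℂ :=
  ((1 / Real.sqrt 2 : ℝ) : ℂ) • (E.J *ᵥ ψ - E.bot)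

theorem ofReal_inv_sqrt_two_mul_self :
    ((1 / Real.sqrt 2 : ℝ) : ℂ) * ((1 / Real.sqrt 2 : ℝ) : ℂ) = 1 / 2 := by
  rw [← Complex.ofReal_mul, div_mul_div_comm, Real.mul_self_sqrt zero_le_two]
  norm_num

variable {φ ψ : Qubits n → ℂ}

theorem Encoding.axis_isState (hψ : IsState ψ) : IsState (E.axis ψ) := by
  rw [IsState, Encoding.axis, star_smul, smul_dotProduct, dotProduct_smul, smul_smul]
  simp only [Complex.star_def, Complex.conj_ofReal]
  rw [ofReal_inv_sqrt_two_mul_self, star_sub, sub_dotProduct, dotProduct_sub, dotProduct_sub,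
    E.dotProduct_J, E.bot_dotProduct, E.dotProduct_bot, hψ, E.bot_isState]
  norm_num

theorem canonicalOracle_mem_unitaryGroup (hψ : IsState ψ) :
    canonicalOracle E ψ ∈ Matrix.unitaryGroup Q ℂ :=
  reflection_mem_unitaryGroup (E.axis_isState hψ)

theorem canonicalOracle_eq (ψ : Qubits n → ℂ) :
    canonicalOracle E ψ = rankOneUpdate 1 (E.J *ᵥ ψ - E.bot) := by
  rw [canonicalOracle, reflection, rankOneUpdate, star_smul, Matrix.smul_vecMulVec,
    Matrix.vecMulVec_smul, smul_smul, smul_smul]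
  congr 2
  simp only [Complex.star_def, Complex.conj_ofReal]
  rw [mul_assoc, ofReal_inv_sqrt_two_mul_self]
  norm_num

/-- The image of `|φ⟩ - |⊥⟩` under the canonical oracle for `ψ`. -/
theorem canonicalOracle_mulVec (φ ψ : Qubits n → ℂ) :
    canonicalOracle E ψ *ᵥ (E.J *ᵥ φ - E.bot) =
      E.J *ᵥ (φ - ψ - (star ψ ⬝ᵥ φ) • ψ) + (star ψ ⬝ᵥ φ) • E.bot := by
  rw [canonicalOracle_eq, rankOneUpdate_mulVec, star_sub, sub_dotProduct, dotProduct_sub,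
    dotProduct_sub, E.dotProduct_J, E.bot_dotProduct, E.dotProduct_bot, E.bot_isState,
    Matrix.mulVec_sub, Matrix.mulVec_sub, Matrix.mulVec_smul]
  module

theorem mul_rankOneUpdate_mul {X : Type} [Fintype X] [DecidableEq X] {O : Matrix X X ℂ}
    (hO : O * O = 1) (hOH : Oᴴ = O) (c : ℂ) (w : X → ℂ) :
    O * rankOneUpdate c w * O = rankOneUpdate c (O *ᵥ w) := by
  rw [rankOneUpdate, Matrix.mul_sub, Matrix.sub_mul, Matrix.mul_one, hO, Matrix.mul_smul,
    Matrix.smul_mul, Matrix.mul_vecMulVec, Matrix.vecMulVec_mul, rankOneUpdate, Matrix.star_mulVec,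
    hOH]

theorem nrm_add_sq {X : Type} [Fintype X] {u v : X → ℂ} (h : star u ⬝ᵥ v = 0) :
    nrm (u + v) ^ 2 = nrm u ^ 2 + nrm v ^ 2 := by
  have h1 : ((nrm (u + v) ^ 2 : ℝ) : ℂ) = ((nrm u ^ 2 + nrm v ^ 2 : ℝ) : ℂ) := by
    rw [← star_dotProduct_self, Complex.ofReal_add, ← star_dotProduct_self,
      ← star_dotProduct_self, star_add, add_dotProduct, dotProduct_add, dotProduct_add, h,
      star_dotProduct_comm v u, h]
    simp
  exact_mod_cast h1

/-- On the encoded space, conjugating the canonical oracle for `φ` by the one for `ψ` nearly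
implements the unitary that maps `φ` to `ψ`. -/
theorem norm_exchange_sub_le (hφ : IsState φ) (hψ : IsState ψ) :
    ‖E.J * exchange φ ψ - canonicalOracle E ψ * canonicalOracle E φ * canonicalOracle E ψ * E.J‖
      ≤ 5 * ‖star ψ ⬝ᵥ φ‖ := by
  set α := star ψ ⬝ᵥ φ with hα
  set c : ℂ := (1 - α)⁻¹ with hc
  have hOU := canonicalOracle_mem_unitaryGroup E hψ
  have hOH : (canonicalOracle E ψ)ᴴ = canonicalOracle E ψ := reflection_conjTranspose _
  have hOO : canonicalOracle E ψ * canonicalOracle E ψ = 1 := by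
    have := Matrix.mem_unitaryGroup_iff'.1 hOU
    rwa [Matrix.star_eq_conjTranspose, hOH] at this
  set v : Q → ℂ := E.J *ᵥ (φ - ψ - α • ψ) + α • E.bot with hv
  have hS : canonicalOracle E ψ * canonicalOracle E φ * canonicalOracle E ψ =
      rankOneUpdate 1 v := by
    rw [canonicalOracle_eq E φ, mul_rankOneUpdate_mul hOO hOH, canonicalOracle_mulVec E]
  have hvn : nrm v ^ 2 = 2 := by
    have h1 : nrm v = nrm (E.J *ᵥ φ - E.bot) := by
      rw [hv, ← canonicalOracle_mulVec E]
      exact nrm_isometry_mulVec (Matrix.mem_unitaryGroup_iff'.1 hOU) _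
    have h2 : star (E.J *ᵥ φ) ⬝ᵥ (-E.bot) = 0 := by rw [dotProduct_neg, E.dotProduct_bot, neg_zero]
    rw [h1, sub_eq_add_neg, nrm_add_sq h2, nrm_isometry_mulVec E.isometry, nrm_eq_one hφ]
    have : nrm (-E.bot) = 1 := by
      rw [← neg_one_smul ℂ E.bot, nrm_smul, nrm_eq_one E.bot_isState]; simp
    rw [this]; norm_num
  have hJv : star v ᵥ* E.J = star (φ - ψ - α • ψ) := by
    have : E.Jᴴ *ᵥ v = φ - ψ - α • ψ := by
      rw [hv, Matrix.mulVec_add, Matrix.mulVec_mulVec, E.isometry, Matrix.one_mulVec,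
        Matrix.mulVec_smul, E.conjTranspose_mulVec_bot, smul_zero, add_zero]
    rw [← this, Matrix.star_mulVec, Matrix.conjTranspose_conjTranspose]
  -- The error is split into two rank-one operators, each of which carries a factor α.
  have hD : E.J * exchange φ ψ - rankOneUpdate 1 v * E.J =
      Matrix.vecMulVec (v - c • (E.J *ᵥ (φ - ψ))) (star (φ - ψ)) -
        Matrix.vecMulVec v (star (α • ψ)) := by
    rw [exchange, rankOneUpdate, rankOneUpdate, Matrix.mul_sub, Matrix.sub_mul, Matrix.mul_one,
      Matrix.one_mul, Matrix.mul_smul, Matrix.smul_mul, Matrix.mul_vecMulVec, Matrix.vecMulVec_mul,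
      hJv, star_sub (φ - ψ), Matrix.vecMulVec_sub, Matrix.sub_vecMulVec, Matrix.smul_vecMulVec,
      one_smul]
    abel
  have hv0 : 0 ≤ nrm v := nrm_nonneg _
  -- Here ‖v‖ = √2 ≤ 3/2. Together with the bound 3|α| below, the total 9/2 is rounded up to 5.
  have h1 : nrm v * nrm (α • ψ) ≤ 3 / 2 * ‖α‖ := by
    rw [nrm_smul, nrm_eq_one hψ, mul_one]
    exact mul_le_mul_of_nonneg_right (by nlinarith) (norm_nonneg _)
  have hα1 : ‖α‖ ≤ 1 := by
    have := norm_dotProduct_le ψ φ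
    rwa [nrm_eq_one hψ, nrm_eq_one hφ, one_mul] at this
  have h2 : nrm (v - c • (E.J *ᵥ (φ - ψ))) * nrm (φ - ψ) ≤ 3 * ‖α‖ := by
    by_cases h0 : 1 - α = 0
    · rw [eq_of_dotProduct_eq_one hφ hψ h0, sub_self]
      have : nrm (0 : Qubits n → ℂ) = 0 := norm_zero
      rw [this, mul_zero]
      positivity
    · have hw : nrm (φ - ψ) ^ 2 ≤ 2 * ‖1 - α‖ := by
        have h3 := star_sub_dotProduct_sub hφ hψ
        rw [star_dotProduct_self] at h3
        have h4 : nrm (φ - ψ) ^ 2 = ‖(1 - α) + star (1 - α)‖ := by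
          rw [← h3, Complex.norm_real, Real.norm_of_nonneg (sq_nonneg _)]
        rw [h4]
        refine (norm_add_le _ _).trans ?_
        rw [norm_star]
        linarith
      have hβ : nrm (φ - α • ψ) ^ 2 = 1 - ‖α‖ ^ 2 := by
        have h3 : star (φ - α • ψ) ⬝ᵥ (α • ψ) = 0 := by
          rw [star_sub, sub_dotProduct, dotProduct_smul, star_smul, smul_dotProduct,
            dotProduct_smul, hψ, star_dotProduct_comm φ ψ, ← hα]
          simp [mul_comm]
        have h4 := nrm_add_sq h3
        rw [sub_add_cancel, nrm_eq_one hφ, nrm_smul, nrm_eq_one hψ] at h4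
        linarith
      -- The difference of the two axes is α times a sum of two orthogonal vectors, with φ - αψ the
      -- part of φ orthogonal to ψ. The coefficient c still has a pole at α = 1, which the factor ‖φ
      -- - ψ‖ compensates.
      have hrem : v - c • (E.J *ᵥ (φ - ψ)) =
          α • (E.bot + (-c) • (E.J *ᵥ (φ - α • ψ))) := by
        have hcα : c * (1 - α) = 1 := inv_mul_cancel₀ h0
        have h3 : φ - ψ - α • ψ - c • (φ - ψ) = α • ((-c) • (φ - α • ψ)) := by
          ext i
          simp only [Pi.sub_apply, Pi.smul_apply, smul_eq_mul]
          linear_combination (-(φ i) + (1 + α) * ψ i) * hcα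
        rw [hv, smul_add, ← Matrix.mulVec_smul, ← Matrix.mulVec_smul, ← Matrix.mulVec_smul, ← h3,
          Matrix.mulVec_sub E.J (φ - ψ - α • ψ)]
        abel
      have hr2 : nrm (E.bot + (-c) • (E.J *ᵥ (φ - α • ψ))) ^ 2 =
          1 + (1 - ‖α‖ ^ 2) / ‖1 - α‖ ^ 2 := by
        rw [nrm_add_sq (by rw [dotProduct_smul, E.bot_dotProduct, smul_zero]), nrm_smul,
          nrm_isometry_mulVec E.isometry, mul_pow, hβ, nrm_eq_one E.bot_isState, norm_neg, hc,
          norm_inv]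
        ring
      rw [hrem, nrm_smul, mul_assoc, mul_comm (3 : ℝ)]
      refine mul_le_mul_of_nonneg_left ?_ (norm_nonneg _)
      have hz : 0 < ‖1 - α‖ := norm_pos_iff.2 h0
      have hz1 : 1 - ‖α‖ ≤ ‖1 - α‖ := by
        have := norm_sub_norm_le (1 : ℂ) α
        rwa [norm_one] at this
      have hz2 : ‖1 - α‖ ≤ 1 + ‖α‖ := by
        have := norm_sub_le (1 : ℂ) α
        rwa [norm_one] at this
      have hq : (1 - ‖α‖ ^ 2) / ‖1 - α‖ ^ 2 * ‖1 - α‖ ≤ 1 + ‖α‖ := by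
        rw [div_mul_eq_mul_div, div_le_iff₀ (by positivity)]
        nlinarith [mul_le_mul_of_nonneg_right hz1 (mul_nonneg hz.le
          (add_nonneg zero_le_one (norm_nonneg α)))]
      -- The square is at most 2|1-α| + 2(1-|α|²)/|1-α| ≤ 4(1+|α|) ≤ 8.
      have hsq : (nrm (E.bot + (-c) • (E.J *ᵥ (φ - α • ψ))) * nrm (φ - ψ)) ^ 2 ≤ 3 ^ 2 := by
        rw [mul_pow, hr2]
        have h5 : 0 ≤ 1 + (1 - ‖α‖ ^ 2) / ‖1 - α‖ ^ 2 := by rw [← hr2]; positivity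
        refine (mul_le_mul_of_nonneg_left hw h5).trans ?_
        nlinarith
      exact (abs_le_of_sq_le_sq hsq (by norm_num)).trans' (le_abs_self _)
  rw [hS, hD]
  refine (norm_sub_le _ _).trans ((add_le_add (norm_vecMulVec_le _ _)
    (norm_vecMulVec_le _ _)).trans ((add_le_add h2 h1).trans ?_))
  nlinarith [norm_nonneg α]

end Estimate

/-! ### Averages over the random oracle -/

section Average

open MeasureTheory

/-- An average over a compact probability space is uniformly approximated by finite averages. -/
theorem exists_finite_average {X : Type} [PseudoMetricSpace X] [CompactSpace X]
    [MeasurableSpace X] [BorelSpace X] (μ : Measure X) [IsProbabilityMeasure μ] {ε : ℝ}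
    (hε : 0 < ε) :
    ∃ (s : Finset X) (p : X → ℝ), (∀ x, 0 ≤ p x) ∧ ∑ x ∈ s, p x = 1 ∧
      ∀ (f : X → ℂ) (c : ℝ), Integrable f μ →
        (∀ x y, dist x y < ε → ‖f x - f y‖ ≤ c) → ‖∫ x, f x ∂μ - ∑ x ∈ s, (p x : ℂ) * f x‖ ≤ c := by
  have hne : Nonempty X := nonempty_of_isProbabilityMeasure μ
  obtain ⟨t, -, htf, ht⟩ := (isCompact_univ (X := X)).finite_cover_balls hε
  obtain ⟨x₀⟩ := hne
  have htne : t.Nonempty := by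
    obtain ⟨y, hy, -⟩ := Set.mem_iUnion₂.1 (ht (Set.mem_univ x₀))
    exact ⟨y, hy⟩
  obtain ⟨e, he⟩ := htf.countable.exists_eq_range htne
  have hidx : ∀ y ∈ t, ∃ k, e k = y := fun y hy => by rw [he] at hy; exact hy
  choose! idx hidx using hidx
  set N := htf.toFinset.sup idx with hN
  -- Points are rounded to a nearest point of a finite initial segment of `e` that contains the
  -- ε-net, and the weights are the measures of the cells. Neither depends on the integrand, which
  -- is what later makes B independent of ψ.
  set s : SimpleFunc X X := SimpleFunc.nearestPt e N with hs
  have hdist : ∀ x, dist x (s x) < ε := fun x => by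
    obtain ⟨y, hy, hxy⟩ := Set.mem_iUnion₂.1 (ht (Set.mem_univ x))
    have hk : idx y ≤ N := Finset.le_sup (htf.mem_toFinset.2 hy)
    have h := SimpleFunc.edist_nearestPt_le e x hk
    rw [hidx y hy, edist_dist, edist_dist, ENNReal.ofReal_le_ofReal_iff dist_nonneg] at h
    rw [dist_comm]
    exact h.trans_lt (by rw [dist_comm]; exact hxy)
  have hm : ∀ y, MeasurableSet (s ⁻¹' {y}) := fun y => s.measurableSet_fiber y
  have hpt : ∀ {E : Type} [NormedAddCommGroup E] (f : X → E) x,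
      f (s x) = ∑ y ∈ s.range, (s ⁻¹' {y}).indicator (fun _ => f y) x := fun f x => by
    rw [Finset.sum_eq_single (s x)]
    · simp
    · intro y _ hy
      simp [Set.indicator, Ne.symm hy]
    · intro h; exact absurd (s.mem_range_self x) h
  have hint : ∀ {E : Type} [NormedAddCommGroup E] [NormedSpace ℝ E] (f : X → E),
      Integrable (fun x => f (s x)) μ := fun f => by
    simp_rw [hpt f]
    exact integrable_finsetSum _ fun y _ => (integrable_const _).indicator (hm y)
  have hsum : ∀ {E : Type} [NormedAddCommGroup E] [NormedSpace ℝ E] [CompleteSpace E] (f : X → E),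
      ∫ x, f (s x) ∂μ = ∑ y ∈ s.range, μ.real (s ⁻¹' {y}) • f y := fun f => by
    simp_rw [hpt f]
    rw [integral_finsetSum _ fun y _ => (integrable_const _).indicator (hm y)]
    exact Finset.sum_congr rfl fun y _ => integral_indicator_const _ (hm y)
  refine ⟨s.range, fun y => μ.real (s ⁻¹' {y}), fun _ => measureReal_nonneg, ?_, ?_⟩
  · have h := hsum (fun _ => (1 : ℝ))
    simpa using h.symm
  · intro f c hf hfc
    have h := hsum f
    simp only [Complex.real_smul] at h
    rw [← h, ← integral_sub hf (hint f)]
    refine (norm_integral_le_of_norm_le_const (C := c)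
      (Filter.Eventually.of_forall fun x => hfc x (s x) (hdist x))).trans ?_
    simp

instance haar_isMulLeftInvariant (n : ℕ) : (haar n).IsMulLeftInvariant := by
  unfold haar; infer_instance

theorem extendByZeroString_mul {n : ℕ} (W W' : ComplementUnitary n) :
    extendByZeroString (W * W') = extendByZeroString W * extendByZeroString W' := by
  simp only [extendByZeroString, Matrix.reindex_apply]
  rw [Matrix.submatrix_mul_equiv, Matrix.fromBlocks_multiply]
  simp

theorem extendByZeroString_conjTranspose_mul_self {n : ℕ} (W : ComplementUnitary n) :
    (extendByZeroString W)ᴴ * extendByZeroString W = 1 := by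
  have hW : W.valᴴ * W.val = 1 := Matrix.mem_unitaryGroup_iff'.1 W.2
  simp only [extendByZeroString, Matrix.reindex_apply]
  rw [Matrix.conjTranspose_submatrix, Matrix.submatrix_mul_equiv, Matrix.fromBlocks_conjTranspose,
    Matrix.fromBlocks_multiply]
  simp [hW]

theorem extendByZeroString_mem_unitaryGroup {n : ℕ} (W : ComplementUnitary n) :
    extendByZeroString W ∈ Matrix.unitaryGroup (Qubits n) ℂ :=
  Matrix.mem_unitaryGroup_iff'.2 (extendByZeroString_conjTranspose_mul_self W)

/-- Every unitary that fixes `|0ⁿ⟩` is the extension of one on the orthogonal complement. -/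
theorem exists_extendByZeroString_eq {n : ℕ} {M : Matrix (Qubits n) (Qubits n) ℂ}
    (hM : M ∈ Matrix.unitaryGroup (Qubits n) ℂ)
    (h0 : M *ᵥ ket (zeroString n) = ket (zeroString n)) :
    ∃ W : ComplementUnitary n, extendByZeroString W = M := by
  have hMM : Mᴴ * M = 1 := Matrix.mem_unitaryGroup_iff'.1 hM
  -- That M† also fixes |0ⁿ⟩ controls the first row, so `M` is block diagonal.
  have h0' : Mᴴ *ᵥ ket (zeroString n) = ket (zeroString n) := by
    conv_lhs => rw [← h0]
    rw [Matrix.mulVec_mulVec, hMM, Matrix.one_mulVec]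
  have hcol : ∀ x, M x (zeroString n) = ket (zeroString n) x := fun x => by
    have := congrFun h0 x
    rwa [ket, Matrix.mulVec_single_one] at this
  have hrow : ∀ x, star (M (zeroString n) x) = ket (zeroString n) x := fun x => by
    have := congrFun h0' x
    rwa [ket, Matrix.mulVec_single_one] at this
  set D : Matrix {x : Qubits n // ¬ x = zeroString n} {x : Qubits n // ¬ x = zeroString n} ℂ :=
    M.submatrix Subtype.val Subtype.val with hD
  have hext : Matrix.reindex (Equiv.sumCompl fun x => x = zeroString n)
      (Equiv.sumCompl fun x => x = zeroString n) (Matrix.fromBlocks 1 0 0 D) = M := by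
    rw [← Equiv.eq_symm_apply]
    ext i j
    rcases i with ⟨i, rfl⟩ | ⟨i, hi⟩ <;> rcases j with ⟨j, hj⟩ | ⟨j, hj⟩
    · subst hj
      simp [hcol]
    · have := hrow j
      rw [ket, Pi.single_eq_of_ne hj, star_eq_zero] at this
      simp [this]
    · subst hj
      have := hcol i
      rw [ket, Pi.single_eq_of_ne hi] at this
      simp [this]
    · simp [hD]
  have hDD : Dᴴ * D = 1 := by
    have h := hMM
    rw [← hext, Matrix.reindex_apply, Matrix.conjTranspose_submatrix, Matrix.submatrix_mul_equiv,
      Matrix.fromBlocks_conjTranspose, Matrix.fromBlocks_multiply] at h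
    have h2 := congrArg (fun A => Matrix.toBlocks₂₂ (A.submatrix
      (Equiv.sumCompl fun x => x = zeroString n) (Equiv.sumCompl fun x => x = zeroString n))) h
    simp only [Matrix.submatrix_submatrix, Equiv.symm_comp_self, Matrix.submatrix_id_id,
      Matrix.toBlocks_fromBlocks₂₂, Matrix.submatrix_one_equiv] at h2
    rw [← Matrix.fromBlocks_one, Matrix.toBlocks_fromBlocks₂₂] at h2
    simpa using h2
  exact ⟨⟨D, Matrix.mem_unitaryGroup_iff'.2 hDD⟩, hext⟩

variable {n a b T : ℕ} (A : Algorithm (Qubits n) a b T)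

/-- The average depends only on the state that is prepared. -/
theorem Algorithm.average_congr {V V' : Matrix (Qubits n) (Qubits n) ℂ}
    (hV : V ∈ Matrix.unitaryGroup (Qubits n) ℂ) (hV' : V' ∈ Matrix.unitaryGroup (Qubits n) ℂ)
    (h : V *ᵥ ket (zeroString n) = V' *ᵥ ket (zeroString n)) : A.average V = A.average V' := by
  have hVV : Vᴴ * V = 1 := Matrix.mem_unitaryGroup_iff'.1 hV
  have hVV' : V * Vᴴ = 1 := Matrix.mem_unitaryGroup_iff.1 hV
  -- V†V' fixes |0ⁿ⟩, so passing from V to V' is a left translation of the sample, under which Haar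
  -- measure is invariant.
  obtain ⟨W₀, hW₀⟩ := exists_extendByZeroString_eq (M := Vᴴ * V')
    (mul_mem (Unitary.star_mem hV) hV')
    (by rw [← Matrix.mulVec_mulVec, ← h, Matrix.mulVec_mulVec, hVV, Matrix.one_mulVec])
  have hR : ∀ W, randomOracle V' W = randomOracle V (W₀ * W) := fun W => by
    rw [randomOracle, randomOracle, extendByZeroString_mul, hW₀, ← Matrix.mul_assoc,
      ← Matrix.mul_assoc, hVV', Matrix.one_mul]
  refine LinearMap.ext fun ρ => ?_
  ext y y'
  change ∫ W, A.run (randomOracle V W) ρ y y' ∂(haar n)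
    = ∫ W, A.run (randomOracle V' W) ρ y y' ∂(haar n)
  simp only [hR]
  exact (integral_mul_left_eq_self (μ := haar n) (fun W => A.run (randomOracle V W) ρ y y') W₀).symm

theorem Algorithm.integrable_trace (V : Matrix (Qubits n) (Qubits n) ℂ) (k : ℕ)
    (M : Matrix (Qubits a × Fin k) (Qubits a × Fin k) ℂ)
    (C : Matrix (Qubits b × Fin k) (Qubits b × Fin k) ℂ) :
    Integrable (fun W => (C * ampliate (A.run (randomOracle V W)) k M).trace) (haar n) := by
  simp only [Matrix.trace, Matrix.diag, Matrix.mul_apply]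
  exact integrable_finsetSum _ fun p _ => integrable_finsetSum _ fun q _ =>
    (A.integrable_run V _ _ _).const_mul _

theorem Algorithm.trace_ampliate_average (V : Matrix (Qubits n) (Qubits n) ℂ) (k : ℕ)
    (M : Matrix (Qubits a × Fin k) (Qubits a × Fin k) ℂ)
    (C : Matrix (Qubits b × Fin k) (Qubits b × Fin k) ℂ) :
    (C * ampliate (A.average V) k M).trace =
      ∫ W, (C * ampliate (A.run (randomOracle V W)) k M).trace ∂(haar n) := by
  have hi : ∀ p q, Integrable
      (fun W => C p q * ampliate (A.run (randomOracle V W)) k M q p) (haar n) := fun p q =>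
    (A.integrable_run V _ _ _).const_mul _
  simp only [Matrix.trace, Matrix.diag, Matrix.mul_apply]
  rw [integral_finsetSum _ fun p _ => integrable_finsetSum _ fun q _ => hi p q]
  refine Finset.sum_congr rfl fun p _ => ?_
  rw [integral_finsetSum _ fun q _ => hi p q]
  refine Finset.sum_congr rfl fun q _ => ?_
  rw [integral_const_mul]
  rfl

end Average

/-! ### Dependence of an algorithm on its oracle -/

section Hybrid

variable {Q : Type} [Fintype Q] [DecidableEq Q] {a b : ℕ}

/-- The same hybrid argument as for the simulation, now for two oracles on one register. It controls
the error of discretizing Haar measure. -/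
theorem Program.dBound_run_sub_run {U U' : Matrix Q Q ℂ} (hU : U ∈ Matrix.unitaryGroup Q ℂ)
    (hU' : U' ∈ Matrix.unitaryGroup Q ℂ) {δ : ℝ} (hδ : ‖U - U'‖ ≤ δ) {w T : ℕ}
    (P : Program Q b w T) : DBound (P.run U - P.run U') (2 * T * δ) := by
  have hδ0 : 0 ≤ δ := (norm_nonneg _).trans hδ
  induction P with
  | output K hK =>
    rw [Program.run, Program.run, sub_self]
    exact dBound_zero.mono (by positivity)
  | instrument K hK next ih =>
    rw [Program.run, Program.run, ← Finset.sum_sub_distrib]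
    simp only [← LinearMap.sub_comp]
    exact DBound.instrument (by positivity) ih hK
  | @query w T kind next ih =>
    have hop := onMemory_conjTranspose_mul_self w (kind.op_conjTranspose_mul_op hU)
    have hop' := onMemory_conjTranspose_mul_self w (kind.op_conjTranspose_mul_op hU')
    have hd : ‖onMemory w (kind.op U) - onMemory w (kind.op U')‖ ≤ δ := by
      have h1 : onMemory w (kind.op U) - onMemory w (kind.op U') =
          onMemory w (kind.op U - kind.op U') := by
        rw [onMemory, onMemory, sub_eq_iff_eq_add, ← Matrix.kronecker_add, sub_add_cancel]
      have h2 := kind.norm_intertwine_le (J := (1 : Matrix Q Q ℂ)) hU hU'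
      rw [onQuery, Matrix.one_kronecker_one, Matrix.one_mul, Matrix.mul_one, Matrix.one_mul,
        Matrix.mul_one] at h2
      rw [h1]
      exact (norm_one_kronecker_le _).trans (h2.trans hδ)
    have h : (Program.query kind next).run U - (Program.query kind next).run U' =
        (next.run U - next.run U') ∘ₗ conj (onMemory w (kind.op U)) +
          (next.run U' ∘ₗ conj (onMemory w (kind.op U)) -
            next.run U' ∘ₗ conj (onMemory w (kind.op U'))) := by
      rw [Program.run_query, Program.run_query, LinearMap.sub_comp]
      abel
    rw [h]
    exact ((ih.comp_conj (by positivity) (norm_isometry_le hop)).add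
      ((Program.dBound_run hU' next).comp_conj_sub_comp_conj (norm_isometry_le hop)
        (norm_isometry_le hop') hd)).mono (by push_cast; linarith)

theorem Algorithm.dBound_run_sub_run {T : ℕ} (A : Algorithm Q a b T) {U U' : Matrix Q Q ℂ}
    (hU : U ∈ Matrix.unitaryGroup Q ℂ) (hU' : U' ∈ Matrix.unitaryGroup Q ℂ) {δ : ℝ}
    (hδ : ‖U - U'‖ ≤ δ) : DBound (A.run U - A.run U') (2 * T * δ) := by
  have hδ0 : 0 ≤ δ := (norm_nonneg _).trans hδ
  rw [Algorithm.run, Algorithm.run, ← Finset.sum_sub_distrib]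
  simp only [← LinearMap.sub_comp]
  exact DBound.instrument (by positivity)
    (fun i => (A.program i).dBound_run_sub_run hU hU' hδ) A.load_complete

end Hybrid

/-- The average over the random oracle is approximated, uniformly in the state that is prepared,
by an average over finitely many samples. -/
theorem Algorithm.exists_finite_average {n a b T : ℕ} (A : Algorithm (Qubits n) a b T) {η : ℝ}
    (hη : 0 < η) :
    ∃ (s : Finset (ComplementUnitary n)) (p : ComplementUnitary n → ℝ),
      (∀ W, 0 ≤ p W) ∧ ∑ W ∈ s, p W = 1 ∧
      ∀ V ∈ Matrix.unitaryGroup (Qubits n) ℂ,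
        DBound (A.average V - ∑ W ∈ s, (p W : ℂ) • A.run (randomOracle V W)) (2 * T * η) := by
  have huc : UniformContinuous (extendByZeroString : ComplementUnitary n → _) :=
    CompactSpace.uniformContinuous_of_continuous (continuous_extendByZeroString n)
  -- One ε serves all V, because left multiplication by a unitary does not increase distances.
  obtain ⟨ε, hε, hlip⟩ := Metric.uniformContinuous_iff.1 huc η hη
  obtain ⟨s, p, hp, hp1, hs⟩ := QuantumQuery.exists_finite_average (haar n) hε
  refine ⟨s, p, hp, hp1, fun V hV k f e C hC => ?_⟩
  rw [ampliate_sub, ampliate_sum, Matrix.mul_sub, Matrix.trace_sub, Matrix.mul_sum,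
    Matrix.trace_sum, A.trace_ampliate_average]
  simp only [ampliate_smul, Matrix.mul_smul, Matrix.trace_smul, smul_eq_mul]
  refine hs _ _ (A.integrable_trace V k _ C) fun W W' hWW' => ?_
  have hmem : ∀ W, randomOracle V W ∈ Matrix.unitaryGroup (Qubits n) ℂ := fun W =>
    mul_mem hV (extendByZeroString_mem_unitaryGroup W)
  have hd : ‖randomOracle V W - randomOracle V W'‖ ≤ η := by
    rw [randomOracle, randomOracle, ← Matrix.mul_sub]
    refine (Matrix.l2_opNorm_mul _ _).trans
      ((mul_le_of_le_one_left (norm_nonneg _) (norm_unitary_le hV)).trans ?_)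
    rw [← dist_eq_norm]
    exact (hlip hWW').le
  have h := A.dBound_run_sub_run (hmem W) (hmem W') hd k f e C hC
  rwa [ampliate_sub, Matrix.mul_sub, Matrix.trace_sub] at h

/-! ### Random choice between simulations -/

section Mixture

variable {X Q : Type} [Fintype X] [DecidableEq X] [Fintype Q] [DecidableEq Q] {a b T : ℕ}

/-- The algorithm that draws `i` with probability `p i` and simulates queries to
`O (S i) O (R i)`, where `O` is the oracle. -/
def Algorithm.mixture (A : Algorithm X a b T) {J : Matrix Q X ℂ} (hJ : Jᴴ * J = 1) (q : Q)
    {ι : Type} [Fintype ι] {p : ι → ℝ} (hp : ∀ i, 0 ≤ p i) (hp1 : ∑ i, p i = 1)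
    {S R : ι → Matrix Q Q ℂ} (hS : ∀ i, S i ∈ Matrix.unitaryGroup Q ℂ)
    (hR : ∀ i, R i ∈ Matrix.unitaryGroup Q ℂ) : Algorithm Q a b (2 * T) where
  w := A.w
  r := Fintype.card (ι × Fin A.r)
  load j := let i := (Fintype.equivFin (ι × Fin A.r)).symm j
    -- The superoperator is quadratic in its operator, so the amplitude √p yields probability p. The
    -- index is drawn once, at loading, and fixes `S` and `R` for all queries of the run.
    ((Real.sqrt (p i.1) : ℝ) : ℂ) • (memoryEmbedding J A.w * A.load i.2)
  load_complete := by
    rw [(Fintype.equivFin (ι × Fin A.r)).symm.sum_comp fun i =>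
      (((Real.sqrt (p i.1) : ℝ) : ℂ) • (memoryEmbedding J A.w * A.load i.2))ᴴ *
        (((Real.sqrt (p i.1) : ℝ) : ℂ) • (memoryEmbedding J A.w * A.load i.2))]
    have h : ∀ i : ι × Fin A.r,
        (((Real.sqrt (p i.1) : ℝ) : ℂ) • (memoryEmbedding J A.w * A.load i.2))ᴴ *
          (((Real.sqrt (p i.1) : ℝ) : ℂ) • (memoryEmbedding J A.w * A.load i.2)) =
        (p i.1 : ℂ) • ((A.load i.2)ᴴ * A.load i.2) := fun i => by
      rw [Matrix.conjTranspose_smul, Matrix.smul_mul, Matrix.mul_smul, smul_smul,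
        Matrix.conjTranspose_mul, Matrix.mul_assoc, ← Matrix.mul_assoc (memoryEmbedding J A.w)ᴴ,
        memoryEmbedding_isometry hJ, Matrix.one_mul, Complex.star_def, Complex.conj_ofReal,
        ← Complex.ofReal_mul, Real.mul_self_sqrt (hp i.1)]
    rw [Finset.sum_congr rfl fun i _ => h i, Fintype.sum_prod_type]
    simp only [← Finset.smul_sum, A.load_complete, ← Finset.sum_smul, ← Complex.ofReal_sum, hp1,
      Complex.ofReal_one, one_smul]
  program j := let i := (Fintype.equivFin (ι × Fin A.r)).symm j
    (A.program i.2).simulate J hJ q (S i.1) (R i.1) (hS i.1) (hR i.1)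

theorem Algorithm.run_mixture (A : Algorithm X a b T) {J : Matrix Q X ℂ} (hJ : Jᴴ * J = 1) (q : Q)
    {ι : Type} [Fintype ι] {p : ι → ℝ} (hp : ∀ i, 0 ≤ p i) (hp1 : ∑ i, p i = 1)
    {S R : ι → Matrix Q Q ℂ} (hS : ∀ i, S i ∈ Matrix.unitaryGroup Q ℂ)
    (hR : ∀ i, R i ∈ Matrix.unitaryGroup Q ℂ) (O : Matrix Q Q ℂ) :
    (A.mixture hJ q hp hp1 hS hR).run O =
      ∑ i, (p i : ℂ) • ∑ j, (((A.program j).simulate J hJ q (S i) (R i) (hS i) (hR i)).run O ∘ₗ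
        conj (memoryEmbedding J A.w)) ∘ₗ conj (A.load j) := by
  rw [Algorithm.run]
  refine ((Fintype.equivFin (ι × Fin A.r)).symm.sum_comp fun i =>
    ((A.program i.2).simulate J hJ q (S i.1) (R i.1) (hS i.1) (hR i.1)).run O ∘ₗ
      conj (((Real.sqrt (p i.1) : ℝ) : ℂ) • (memoryEmbedding J A.w * A.load i.2))).trans ?_
  rw [Fintype.sum_prod_type]
  refine Finset.sum_congr rfl fun i _ => ?_
  rw [Finset.smul_sum]
  refine Finset.sum_congr rfl fun j _ => ?_
  rw [conj_smul, Complex.star_def, Complex.conj_ofReal, ← Complex.ofReal_mul,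
    Real.mul_self_sqrt (hp i), LinearMap.comp_smul, LinearMap.comp_assoc, conj_comp_conj]

theorem Algorithm.dBound_run_sub_simulate (A : Algorithm X a b T) {J : Matrix Q X ℂ}
    (hJ : Jᴴ * J = 1) (q : Q) {O S R : Matrix Q Q ℂ} (hO : O ∈ Matrix.unitaryGroup Q ℂ)
    (hS : S ∈ Matrix.unitaryGroup Q ℂ) (hR : R ∈ Matrix.unitaryGroup Q ℂ)
    {U : Matrix X X ℂ} (hU : U ∈ Matrix.unitaryGroup X ℂ) {δ : ℝ}
    (hδ : ‖J * U - O * S * O * R * J‖ ≤ δ) :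
    DBound (A.run U - ∑ j, (((A.program j).simulate J hJ q S R hS hR).run O ∘ₗ
        conj (memoryEmbedding J A.w)) ∘ₗ conj (A.load j)) (2 * T * δ) := by
  have hδ0 : 0 ≤ δ := (norm_nonneg _).trans hδ
  rw [Algorithm.run, ← Finset.sum_sub_distrib]
  simp only [← LinearMap.sub_comp]
  exact DBound.instrument (by positivity)
    (fun j => (A.program j).dBound_run_sub_simulate hJ q hO hS hR hU hδ) A.load_complete

/-- The unitary on the codomain of an isometry `J` that acts as `R` on the range of `J` and
trivially on its complement. -/
def extendByIsometry (J : Matrix Q X ℂ) (R : Matrix X X ℂ) : Matrix Q Q ℂ :=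
  J * R * Jᴴ + (1 - J * Jᴴ)

theorem extendByIsometry_mul {J : Matrix Q X ℂ} (hJ : Jᴴ * J = 1) (R : Matrix X X ℂ) :
    extendByIsometry J R * J = J * R := by
  rw [extendByIsometry, Matrix.add_mul, Matrix.sub_mul, Matrix.mul_assoc (J * R), hJ,
    Matrix.mul_assoc J Jᴴ, hJ, Matrix.mul_one, Matrix.mul_one, Matrix.one_mul, sub_self, add_zero]

theorem extendByIsometry_mem_unitaryGroup {J : Matrix Q X ℂ} (hJ : Jᴴ * J = 1)
    {R : Matrix X X ℂ} (hR : R ∈ Matrix.unitaryGroup X ℂ) :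
    extendByIsometry J R ∈ Matrix.unitaryGroup Q ℂ := by
  have hRR : Rᴴ * R = 1 := Matrix.mem_unitaryGroup_iff'.1 hR
  have h1 : (extendByIsometry J R)ᴴ = extendByIsometry J Rᴴ := by
    simp [extendByIsometry, Matrix.mul_assoc]
  have h2 : extendByIsometry J Rᴴ * (1 - J * Jᴴ) = 1 - J * Jᴴ := by
    have h3 : J * Jᴴ * (J * Jᴴ) = J * Jᴴ := by
      rw [Matrix.mul_assoc, ← Matrix.mul_assoc Jᴴ, hJ, Matrix.one_mul]
    rw [Matrix.mul_sub, Matrix.mul_one, ← Matrix.mul_assoc, extendByIsometry_mul hJ,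
      extendByIsometry, add_sub_cancel_left]
  refine Matrix.mem_unitaryGroup_iff'.2 ?_
  rw [Matrix.star_eq_conjTranspose, h1]
  conv_lhs => rw [extendByIsometry.eq_1 J R]
  rw [Matrix.mul_add, h2, ← Matrix.mul_assoc, ← Matrix.mul_assoc, extendByIsometry_mul hJ,
    Matrix.mul_assoc J, hRR, Matrix.mul_one, add_sub_cancel]

end Mixture

/-! ### Random basis states and the error they cause -/

section Final

variable {n : ℕ}

/-- A permutation of the computational basis that maps `|0ⁿ⟩` to `|x⟩`. -/
def shift (x : Qubits n) : Matrix (Qubits n) (Qubits n) ℂ :=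
  (Equiv.swap (zeroString n) x).permMatrix ℂ

theorem shift_mulVec (x : Qubits n) : shift x *ᵥ ket (zeroString n) = ket x := by
  rw [ket, Matrix.mulVec_single_one]
  ext y
  simp only [shift, Matrix.col_apply, Equiv.Perm.permMatrix, PEquiv.toMatrix_apply,
    Equiv.toPEquiv_apply, Option.mem_def, Option.some.injEq, Pi.single_apply]
  refine if_congr ?_ rfl rfl
  rw [Equiv.swap_apply_eq_iff, Equiv.swap_apply_left]

theorem shift_mem_unitaryGroup (x : Qubits n) :
    shift x ∈ Matrix.unitaryGroup (Qubits n) ℂ := by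
  rw [Matrix.mem_unitaryGroup_iff', Matrix.star_eq_conjTranspose, shift,
    Matrix.conjTranspose_permMatrix, ← Matrix.permMatrix_mul]
  simp

theorem ket_isState (x : Qubits n) : IsState (ket x) := by
  simp [IsState, ket]

/-- Cauchy–Schwarz against the all-ones vector of length 2ⁿ. Divided by 2ⁿ, it says that a uniformly
random basis state has mean overlap at most 2^(-n/2) with ψ. -/
theorem sum_norm_le_sqrt {ψ : Qubits n → ℂ} (hψ : IsState ψ) :
    ∑ x, ‖ψ x‖ ≤ (2 : ℝ) ^ ((n : ℝ) / 2) := by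
  have h := Finset.sum_mul_sq_le_sq_mul_sq Finset.univ (fun _ : Qubits n => (1 : ℝ)) fun x => ‖ψ x‖
  rw [← nrm_sq, nrm_eq_one hψ] at h
  simp only [one_mul, one_pow, Finset.sum_const, Finset.card_univ, Fintype.card_fun,
    Fintype.card_bool, Fintype.card_fin, nsmul_eq_mul, mul_one, Nat.cast_pow, Nat.cast_ofNat] at h
  have h2 : ((2 : ℝ) ^ ((n : ℝ) / 2)) ^ 2 = 2 ^ n := by
    rw [← Real.rpow_natCast, ← Real.rpow_mul zero_le_two, ← Real.rpow_natCast]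
    norm_num
  rw [← h2] at h
  exact (abs_le_of_sq_le_sq h (by positivity)).trans' (le_abs_self _)

/-- Conditional on the basis state `x` that replaces `ψ`, the simulation is close to a run
with oracle `exchange |x⟩ ψ * shift x * W`. -/
theorem norm_randomOracle_sub_le {Q : Type} [Fintype Q] [DecidableEq Q] (E : Encoding n Q)
    {ψ : Qubits n → ℂ} (hψ : IsState ψ) (x : Qubits n) (W : ComplementUnitary n) :
    ‖E.J * randomOracle (exchange (ket x) ψ * shift x) W -
        canonicalOracle E ψ * canonicalOracle E (ket x) * canonicalOracle E ψ *
          extendByIsometry E.J (shift x * extendByZeroString W) * E.J‖ ≤ 5 * ‖ψ x‖ := by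
  have hR : shift x * extendByZeroString W ∈ Matrix.unitaryGroup (Qubits n) ℂ :=
    mul_mem (shift_mem_unitaryGroup x) (extendByZeroString_mem_unitaryGroup W)
  have h : E.J * randomOracle (exchange (ket x) ψ * shift x) W -
        canonicalOracle E ψ * canonicalOracle E (ket x) * canonicalOracle E ψ *
          extendByIsometry E.J (shift x * extendByZeroString W) * E.J =
      (E.J * exchange (ket x) ψ - canonicalOracle E ψ * canonicalOracle E (ket x) *
        canonicalOracle E ψ * E.J) * (shift x * extendByZeroString W) := by
    rw [Matrix.mul_assoc _ (extendByIsometry _ _), extendByIsometry_mul E.isometry, randomOracle,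
      Matrix.sub_mul]
    simp only [Matrix.mul_assoc]
  have hα : ‖star ψ ⬝ᵥ ket x‖ = ‖ψ x‖ := by
    rw [ket, dotProduct_single_one, Pi.star_apply, norm_star]
  rw [h, ← hα]
  exact (Matrix.l2_opNorm_mul _ _).trans
    ((mul_le_of_le_one_right (norm_nonneg _) (norm_unitary_le hR)).trans
      (norm_exchange_sub_le E (ket_isState x) hψ))

end Final

end QuantumQuery

end

/-! ### Assembly of the simulation and its error bound -/

open QuantumQuery in
theorem theorem4p1 (n : ℕ) {Q : Type} [Fintype Q] [DecidableEq Q]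
    (E : QuantumQuery.Encoding n Q) (a b T : ℕ)
    (A : QuantumQuery.Algorithm (QuantumQuery.Qubits n) a b T) :
    ∃ B : QuantumQuery.Algorithm Q a b (2 * T),
      ∀ ψ : QuantumQuery.Qubits n → ℂ, QuantumQuery.IsState ψ →
        ∀ V ∈ Matrix.unitaryGroup (QuantumQuery.Qubits n) ℂ,
          V *ᵥ QuantumQuery.ket (QuantumQuery.zeroString n) = ψ →
            QuantumQuery.diamondNorm
                (A.average V - B.run (QuantumQuery.canonicalOracle E ψ)) ≤
              ENNReal.ofReal ((10 * (T : ℝ) + 4) / (2 : ℝ) ^ ((n : ℝ) / 2)) := by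
  set N : ℝ := (2 : ℝ) ^ ((n : ℝ) / 2) with hN
  have hN0 : 0 < N := by positivity
  have hNN : N * N = 2 ^ n := by
    rw [hN, ← Real.rpow_add two_pos, add_halves, Real.rpow_natCast]
  -- The label q is only the reset value for branches outside the encoded space; it exists since ⊥
  -- is a unit vector.
  obtain ⟨q⟩ : Nonempty Q := by
    by_contra h
    rw [not_nonempty_iff] at h
    simpa [IsState, dotProduct] using E.bot_isState
  -- This precision makes the discretization error 2Tη at most 4/N; T + 1 instead of T covers T = 0.
  have hη : 0 < 2 / ((T + 1) * N) := by positivity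
  obtain ⟨s, p, hp, hp1, hs⟩ := A.exists_finite_average hη
  have hcard : ∑ _x : Qubits n, ((2 : ℝ) ^ n)⁻¹ = 1 := by
    simp
  have hw1 : ∑ i : Qubits n × s, ((2 : ℝ) ^ n)⁻¹ * p i.2 = 1 := by
    rw [Fintype.sum_prod_type]
    simp only [← Finset.mul_sum]
    rw [Finset.sum_coe_sort s p, hp1]
    simp
  refine ⟨A.mixture E.isometry q (ι := Qubits n × s) (p := fun i => ((2 : ℝ) ^ n)⁻¹ * p i.2)
    (fun i => mul_nonneg (by positivity) (hp _)) hw1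
    (S := fun i => canonicalOracle E (ket i.1))
    (R := fun i => extendByIsometry E.J (shift i.1 * extendByZeroString i.2.1))
    (fun i => canonicalOracle_mem_unitaryGroup E (ket_isState i.1))
    (fun i => extendByIsometry_mem_unitaryGroup E.isometry
      (mul_mem (shift_mem_unitaryGroup i.1) (extendByZeroString_mem_unitaryGroup i.2.1))), ?_⟩
  intro ψ hψ V hV hVψ
  refine DBound.diamondNorm_le (by positivity) ?_
  rw [Algorithm.run_mixture, Fintype.sum_prod_type]
  have hO := canonicalOracle_mem_unitaryGroup E hψ
  have hFV : ∀ x : Qubits n, exchange (ket x) ψ * shift x ∈ Matrix.unitaryGroup (Qubits n) ℂ :=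
    fun x => mul_mem (exchange_mem_unitaryGroup (ket_isState x) hψ) (shift_mem_unitaryGroup x)
  -- Each x gets its own unitary preparing ψ; all of them give the same Haar average, so the bounds
  -- for the individual x can be averaged.
  have havg : ∀ x : Qubits n, A.average V = A.average (exchange (ket x) ψ * shift x) := fun x =>
    A.average_congr hV (hFV x) (by
      rw [hVψ, ← Matrix.mulVec_mulVec, shift_mulVec, exchange_mulVec (ket_isState x) hψ])
  set Ψ : Qubits n → s →
      (Matrix (Qubits a) (Qubits a) ℂ →ₗ[ℂ] Matrix (Qubits b) (Qubits b) ℂ) := fun x W =>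
    ∑ j, (((A.program j).simulate E.J E.isometry q (canonicalOracle E (ket x))
      (extendByIsometry E.J (shift x * extendByZeroString W.1))
      (canonicalOracle_mem_unitaryGroup E (ket_isState x))
      (extendByIsometry_mem_unitaryGroup E.isometry (mul_mem (shift_mem_unitaryGroup x)
        (extendByZeroString_mem_unitaryGroup W.1)))).run (canonicalOracle E ψ) ∘ₗ
        conj (memoryEmbedding E.J A.w)) ∘ₗ conj (A.load j) with hΨ
  have hsim : ∀ (x : Qubits n) (W : s),
      DBound (A.run (randomOracle (exchange (ket x) ψ * shift x) W.1) - Ψ x W)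
        (2 * T * (5 * ‖ψ x‖)) := fun x W =>
    A.dBound_run_sub_simulate E.isometry q hO _ _
      (mul_mem (hFV x) (extendByZeroString_mem_unitaryGroup W.1))
      (norm_randomOracle_sub_le E hψ x W.1)
  have hx : ∀ x : Qubits n, DBound (A.average V - ∑ W : s, (p W : ℂ) • Ψ x W)
      (2 * T * (2 / ((T + 1) * N)) + 2 * T * (5 * ‖ψ x‖)) := fun x => by
    have h1 := hs _ (hFV x)
    rw [← havg x, ← Finset.sum_coe_sort] at h1
    have h2 := DBound.sum fun W : s => (hsim x W).smul (p W : ℂ)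
    have h3 : ∑ W : s, ‖(p W : ℂ)‖ * (2 * T * (5 * ‖ψ x‖)) = 2 * T * (5 * ‖ψ x‖) := by
      rw [← Finset.sum_mul]
      simp only [Complex.norm_real, Real.norm_of_nonneg (hp _)]
      rw [Finset.sum_coe_sort s p, hp1, one_mul]
    rw [h3] at h2
    have h4 := h1.add h2
    simp only [smul_sub, Finset.sum_sub_distrib, sub_add_sub_cancel] at h4
    exact h4
  have hmix := DBound.sum fun x : Qubits n => (hx x).smul ((((2 : ℝ) ^ n)⁻¹ : ℝ) : ℂ)
  have heq : A.average V -
      ∑ x : Qubits n, ∑ W : s, ((((2 : ℝ) ^ n)⁻¹ * p W : ℝ) : ℂ) • Ψ x W =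
      ∑ x : Qubits n, ((((2 : ℝ) ^ n)⁻¹ : ℝ) : ℂ) •
        (A.average V - ∑ W : s, (p W : ℂ) • Ψ x W) := by
    simp only [smul_sub, Finset.sum_sub_distrib, Finset.smul_sum, smul_smul, Complex.ofReal_mul]
    rw [← Finset.sum_smul, ← Complex.ofReal_sum, hcard, Complex.ofReal_one, one_smul]
  -- The simulation contributes 2T · 5 · N/N² = 10T/N and the discretization at most 4/N.
  have hle : ∑ x : Qubits n, ‖((((2 : ℝ) ^ n)⁻¹ : ℝ) : ℂ)‖ *
      (2 * T * (2 / ((T + 1) * N)) + 2 * T * (5 * ‖ψ x‖)) ≤ (10 * T + 4) / N := by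
    have h1 : ‖((((2 : ℝ) ^ n)⁻¹ : ℝ) : ℂ)‖ = ((2 : ℝ) ^ n)⁻¹ := by
      rw [Complex.norm_real, Real.norm_of_nonneg (by positivity)]
    simp only [h1, mul_add, Finset.sum_add_distrib]
    rw [← Finset.sum_mul, hcard, one_mul, ← Finset.mul_sum, ← Finset.mul_sum, ← Finset.mul_sum,
      add_comm, add_div]
    refine add_le_add ?_ ?_
    · rw [← hNN]
      have h2 := sum_norm_le_sqrt hψ
      rw [← hN] at h2
      calc (N * N)⁻¹ * (2 * T * (5 * ∑ x, ‖ψ x‖)) ≤ (N * N)⁻¹ * (2 * T * (5 * N)) := by gcongr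
        _ = 10 * T / N := by field_simp; ring
    · rw [mul_div_assoc', div_le_div_iff₀ (by positivity) hN0]
      nlinarith
  exact heq ▸ hmix.mono hle
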